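/- Let $B=[b_{ij}]$ be an $n\times n$ integer matrix that is skew-symmetrizable, i.e. $\delta_ib_{ij}=-\delta_jb_{ji}$ for some positive reals $\delta_i$, and let $A=[a_{ij}]$ be its Cartan matrix: $a_{ii}=2$ and $a_{ij}=-|b_{ij}|$ for $i\neq j$. Let $V$ be the real vector space with basis the simple roots $\alpha_1,\ldots,\alpha_n$, let $V^*$ be its dual, and for $\beta\in V$ write $\beta^\perp=\{p\in V^*:\langle p,\beta\rangle=0\}$. Let $Q^+$ be the set of nonzero nonnegative integer combinations of the $\alpha_i$. Let $W$ be the Coxeter group generated by the simple reflections $s_i\colon\alpha_j\mapsto\alpha_j-a_{ij}\alpha_i$, with length function $\ell$. The roots are the vectors $w\alpha_i$ with $w\in W$; a root is positive if it is a nonnegative combination of simple roots. To each reflection $t=ws_iw^{-1}$ of $W$ corresponds the positive root $\beta_t=\pm w\alpha_i$. The cover reflections of $w\in W$ are the reflections $t$ such that $\ell(tw)<\ell(w)$ and $tw=ws_i$ for some $i$; $\mathrm{cov}(w)$ is the set of these. Assume that $B$ is acyclic (there is no cycle of indices $i_0,\ldots,i_\ell=i_0$, $\ell\ge1$, with $b_{i_{k-1}i_k}>0$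 for all $k$) and of finite type ($W$ is finite). Let $c$ be the Coxeter element determined by $B$, i.e. the product of $s_1,\ldots,s_n$ in any order in which $s_i$ precedes $s_j$ whenever $b_{ij}>0$. Let $\omega_c$ be the bilinear form on $V$ with $\omega_c(\alpha_i,\alpha_j)=\delta_ib_{ij}$ (so that $\omega_c(\delta_i^{-1}\alpha_i,\alpha_j)=b_{ij}$). The $c$-sortable elements of $W$ and of its standard parabolic subgroups $W_J$ (for Coxeter elements $c$ of $W_J$), and for each $c$-sortable $v$ a set $C_c(v)$ of roots, are defined recursively. The identity is $c$-sortable and $C_c(1)$ is the set of simple roots of $W_J$. For $s=s_i$ initial in $c$ (that is, first in some expression of $c$ as a product of the simple reflections of $W_J$, each used once): if $\ell(sv)<\ell(v)$, then $v$ is $c$-sortable if and only if $sv$ is $scs$-sortable, and $C_c(v)=sC_{scs}(sv)$; if $\ell(sv)>\ell(v)$, then $v$ is $c$-sortable if and only if $v\in W_{J\setminus\{i\}}$ and $v$ is $sc$-sortable in $W_{J\setminus\{i\}}$, and $C_c(v)=C_{sc}(v)\cup\{\alpha_i\}$. Put $\mathrm{Cone}_c(v)=\{p\in V^*:\langle p,\beta\rangle\ge0\text{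 for all }\beta\in C_c(v)\}$. The $c$-Cambrian scattering diagram, with coefficients in a field of characteristic zero, is the set of walls $$\operatorname{CambScat}(A,c)=\{(\mathrm{Cone}_c(v)\cap\beta_t^\perp,\ 1+\hat y^{\beta_t}):v\ c\text{-sortable},\ t\in\mathrm{cov}(v)\}.$$ A wall $(\mathfrak d,f)$ is incoming if $\omega_c(\,\cdot\,,\beta)\in\mathfrak d$, where $\beta\in Q^+$ is the primitive vector (one that is not $k\beta'$ with $k>1$ and $\beta'$ an integer combination of the $\alpha_i$) such that $\mathfrak d\subseteq\beta^\perp$; otherwise it is outgoing. Proposition. (1) Every wall of $\operatorname{CambScat}(A,c)$ that is not contained in some $\alpha_i^\perp$ is outgoing. (2) Equivalently, for every $c$-sortable element $v$ of $W$ and every positive root $\beta\in C_c(v)\setminus\{\alpha_1,\ldots,\alpha_n\}$, the vector $\omega_c(\,\cdot\,,\beta)\in V^*$ is not in $\mathrm{Cone}_c(v)$. -/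

import Mathlib

open scoped BigOperators

noncomputable section

namespace CambScat

variable {ι : Type*} [Fintype ι] [DecidableEq ι]

/- The real vector space `V` with distinguished basis the simple roots `α i`, indexed by `ι`,
is `ι → ℝ`; the root lattice `Q` is `ι → ℤ`, included in `V` by the cast. -/

/-- The simple root `α_i`. -/
def simpleRoot (i : ι) : ι → ℝ := Pi.single i 1

/-- `δ` skew-symmetrizes `B`: the `δ_i` are positive and `δ_i b_ij = - δ_j b_ji`. -/
def SkewSymmetrizes (δ : ι → ℝ) (B : Matrix ι ι ℤ) : Prop :=
  (∀ i, 0 < δ i) ∧ ∀ i j, δ i * (B i j : ℝ) = -(δ j * (B j i : ℝ))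

/-- `B` is acyclic: there is no cycle of indices along which the entries of `B` are positive. -/
def IsAcyclic (B : Matrix ι ι ℤ) : Prop :=
  ∀ i, ¬ Relation.TransGen (fun j k => 0 < B j k) i i

/-- The Cartan matrix of `B`: `a_ii = 2` and `a_ij = -|b_ij|` for `i ≠ j`. -/
def cartan (B : Matrix ι ι ℤ) : Matrix ι ι ℤ :=
  Matrix.of fun i j => if i = j then 2 else -|B i j|

/-- The functional `K(α_i^∨, ·)` on `V`, with `K(α_i^∨, α_j) = a_ij`. -/
def corootForm (B : Matrix ι ι ℤ) (i : ι) : Module.Dual ℝ (ι → ℝ) :=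
  ∑ j, (cartan B i j : ℝ) • LinearMap.proj j

theorem corootForm_simpleRoot (B : Matrix ι ι ℤ) (i j : ι) :
    corootForm B i (simpleRoot j) = (cartan B i j : ℝ) := by
  simp [corootForm, simpleRoot, Pi.single_apply]

theorem corootForm_self (B : Matrix ι ι ℤ) (i : ι) :
    corootForm B i (simpleRoot i) = 2 := by
  simp [corootForm_simpleRoot, cartan]

/-- The simple reflection `s_i` on `V`, with `s_i α_j = α_j - a_ij α_i`. -/
def s (B : Matrix ι ι ℤ) (i : ι) : (ι → ℝ) ≃ₗ[ℝ] (ι → ℝ) :=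
  Module.reflection (corootForm_self B i)

theorem s_simpleRoot (B : Matrix ι ι ℤ) (i j : ι) :
    s B i (simpleRoot j) = simpleRoot j - (cartan B i j : ℝ) • simpleRoot i := by
  rw [s, Module.reflection_apply, corootForm_simpleRoot]

/-- The product `s_{i_1} ⋯ s_{i_k}` of the word `[i_1, …, i_k]`. -/
def wordProd (B : Matrix ι ι ℤ) (l : List ι) : (ι → ℝ) ≃ₗ[ℝ] (ι → ℝ) := (l.map (s B)).prod

/-- The standard parabolic subgroup generated by the `s_j` with `j ∈ J`. -/
def parabolic (B : Matrix ι ι ℤ) (J : Finset ι) : Subgroup ((ι → ℝ) ≃ₗ[ℝ] (ι → ℝ)) :=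
  Subgroup.closure (s B '' (J : Set ι))

/-- The Coxeter group `W` generated by the simple reflections. -/
def weylGroup (B : Matrix ι ι ℤ) : Subgroup ((ι → ℝ) ≃ₗ[ℝ] (ι → ℝ)) :=
  parabolic B Finset.univ

/-- `B` is of finite type: its Coxeter group is finite. -/
def IsFiniteType (B : Matrix ι ι ℤ) : Prop := Finite (weylGroup B)

/-- The length of `w ∈ W`: the smallest number of letters in a word for `w`. (The length of an
element of a standard parabolic subgroup is the same in the subgroup as in `W`.) -/
def len (B : Matrix ι ι ℤ) (w : (ι → ℝ) ≃ₗ[ℝ] (ι → ℝ)) : ℕ :=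
  sInf {k | ∃ l : List ι, l.length = k ∧ wordProd B l = w}

/-- The positive (real) roots: the vectors `w α_i`, `w ∈ W`, that are nonnegative combinations of
the simple roots. -/
def positiveRoots (B : Matrix ι ι ℤ) : Set (ι → ℝ) :=
  {β | (∃ w ∈ weylGroup B, ∃ i, β = w (simpleRoot i)) ∧ ∀ i, 0 ≤ β i}

/-- `t` is a reflection of `W` and `β` is the positive root `β_t` corresponding to it: `t` is
`w s_i w⁻¹` and `β` is the positive root `w α_i`. -/
def IsReflectionWithRoot (B : Matrix ι ι ℤ) (t : (ι → ℝ) ≃ₗ[ℝ] (ι → ℝ)) (β : ι → ℝ) : Prop :=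
  β ∈ positiveRoots B ∧ ∃ w ∈ weylGroup B, ∃ i, t = w * s B i * w⁻¹ ∧ β = w (simpleRoot i)

/-- The cover reflections of `w`: the inversions `t` of `w` such that `t w = w s_i` for some `i`. -/
def cov (B : Matrix ι ι ℤ) (w : (ι → ℝ) ≃ₗ[ℝ] (ι → ℝ)) : Set ((ι → ℝ) ≃ₗ[ℝ] (ι → ℝ)) :=
  {t | (∃ β, IsReflectionWithRoot B t β) ∧ len B (t * w) < len B w ∧ ∃ i, t * w = w * s B i}

/-- `l` lists each element of `J` exactly once, and the product of the corresponding simple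
reflections is `c`. -/
def IsCoxeterWord (B : Matrix ι ι ℤ) (J : Finset ι) (c : (ι → ℝ) ≃ₗ[ℝ] (ι → ℝ))
    (l : List ι) : Prop :=
  l.Nodup ∧ l.toFinset = J ∧ wordProd B l = c

/-- `c` is a Coxeter element of the standard parabolic subgroup `W_J`. -/
def IsCoxeterElement (B : Matrix ι ι ℤ) (J : Finset ι) (c : (ι → ℝ) ≃ₗ[ℝ] (ι → ℝ)) : Prop :=
  ∃ l, IsCoxeterWord B J c l

/-- `c` is the Coxeter element of `W` determined by `B`: the product of the simple reflections in
an order in which `s_i` precedes `s_j` whenever `b_ij > 0`. -/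
def IsCoxeterElementOf (B : Matrix ι ι ℤ) (c : (ι → ℝ) ≃ₗ[ℝ] (ι → ℝ)) : Prop :=
  ∃ l, IsCoxeterWord B Finset.univ c l ∧ l.Pairwise (fun i j => ¬ 0 < B j i)

/-- `s_i` is initial in the Coxeter element `c` of `W_J`. -/
def IsInitial (B : Matrix ι ι ℤ) (J : Finset ι) (c : (ι → ℝ) ≃ₗ[ℝ] (ι → ℝ)) (i : ι) : Prop :=
  ∃ l, IsCoxeterWord B J c (i :: l)

/-- `IsSortable B J c w`: the element `w` of `W_J` is `c`-sortable, where `c` is a Coxeter element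
of `W_J`. -/
inductive IsSortable (B : Matrix ι ι ℤ) :
    Finset ι → ((ι → ℝ) ≃ₗ[ℝ] (ι → ℝ)) → ((ι → ℝ) ≃ₗ[ℝ] (ι → ℝ)) → Prop
  | one (J : Finset ι) (c : (ι → ℝ) ≃ₗ[ℝ] (ι → ℝ)) :
      IsCoxeterElement B J c → IsSortable B J c 1
  | descent (J : Finset ι) (c w : (ι → ℝ) ≃ₗ[ℝ] (ι → ℝ)) (i : ι) :
      IsInitial B J c i → w ∈ parabolic B J → len B (s B i * w) < len B w →
      IsSortable B J (s B i * c * s B i) (s B i * w) → IsSortable B J c w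
  | ascent (J : Finset ι) (c w : (ι → ℝ) ≃ₗ[ℝ] (ι → ℝ)) (i : ι) :
      IsInitial B J c i → w ∈ parabolic B (J.erase i) → len B w < len B (s B i * w) →
      IsSortable B (J.erase i) (s B i * c) w → IsSortable B J c w

/-- `IsLabelSet B J c v C`: the set `C` is `C_c(v)`, where `c` is a Coxeter element of `W_J` and
`v ∈ W_J` is `c`-sortable. -/
inductive IsLabelSet (B : Matrix ι ι ℤ) :
    Finset ι → ((ι → ℝ) ≃ₗ[ℝ] (ι → ℝ)) → ((ι → ℝ) ≃ₗ[ℝ] (ι → ℝ)) → Set (ι → ℝ) → Prop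
  | one (J : Finset ι) (c : (ι → ℝ) ≃ₗ[ℝ] (ι → ℝ)) :
      IsCoxeterElement B J c → IsLabelSet B J c 1 (simpleRoot '' (J : Set ι))
  | descent (J : Finset ι) (c v : (ι → ℝ) ≃ₗ[ℝ] (ι → ℝ)) (i : ι) (C : Set (ι → ℝ)) :
      IsInitial B J c i → len B (s B i * v) < len B v →
      IsLabelSet B J (s B i * c * s B i) (s B i * v) C → IsLabelSet B J c v (s B i '' C)
  | ascent (J : Finset ι) (c v : (ι → ℝ) ≃ₗ[ℝ] (ι → ℝ)) (i : ι) (C : Set (ι → ℝ)) :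
      IsInitial B J c i → len B v < len B (s B i * v) →
      IsLabelSet B (J.erase i) (s B i * c) v C → IsLabelSet B J c v (insert (simpleRoot i) C)

/-- The label set `C_c(v)` exists for every `c`-sortable `v`. -/
theorem IsSortable.exists_isLabelSet {B : Matrix ι ι ℤ} {J : Finset ι}
    {c v : (ι → ℝ) ≃ₗ[ℝ] (ι → ℝ)} (h : IsSortable B J c v) : ∃ C, IsLabelSet B J c v C := by
  induction h with
  | one J c h => exact ⟨_, .one J c h⟩
  | descent J c w i hi _ hl _ ih =>
    obtain ⟨C, hC⟩ := ih
    exact ⟨_, .descent J c w i C hi hl hC⟩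
  | ascent J c w i hi _ hl _ ih =>
    obtain ⟨C, hC⟩ := ih
    exact ⟨_, .ascent J c w i C hi hl hC⟩

/-- The cone in `V*` of the points that are nonnegative on `C`. This is `Cone_c(v)` if `C` is
`C_c(v)`. -/
def dualCone (C : Set (ι → ℝ)) : Set (Module.Dual ℝ (ι → ℝ)) :=
  {p | ∀ β ∈ C, 0 ≤ p β}

/-- The hyperplane `β^⊥` in `V*`. -/
def perp (β : ι → ℝ) : Set (Module.Dual ℝ (ι → ℝ)) := {p | p β = 0}

/-- The bilinear form `ω` on `V`: as `α_i = δ_i α_i^∨` and `ω(α_i^∨, α_j) = b_ij`, it has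
`ω(α_i, α_j) = δ_i b_ij`. -/
def omega (δ : ι → ℝ) (B : Matrix ι ι ℤ) : LinearMap.BilinForm ℝ (ι → ℝ) :=
  Matrix.toBilin' (Matrix.of fun i j => δ i * (B i j : ℝ))

/-- The vector `ω(·, β)` of `V*`. -/
def omegaVec (δ : ι → ℝ) (B : Matrix ι ι ℤ) (β : ι → ℝ) : Module.Dual ℝ (ι → ℝ) :=
  (omega δ B).flip β

/-- `β ∈ Q⁺` is primitive: it is not `k β'` with `k > 1` and `β'` in the root lattice. -/
def IsPrimitivePos (β : ι → ℤ) : Prop :=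
  (0 ≤ β ∧ β ≠ 0) ∧ ∀ (k : ℤ) (β' : ι → ℤ), 1 < k → β ≠ k • β'

/-- The wall (with support) `d` is incoming: `ω(·, β) ∈ d`, for the primitive `β ∈ Q⁺` such that
`d` is contained in `β^⊥`. -/
def IsIncoming (δ : ι → ℝ) (B : Matrix ι ι ℤ) (d : Set (Module.Dual ℝ (ι → ℝ))) : Prop :=
  ∃ β : ι → ℤ, IsPrimitivePos β ∧ d ⊆ perp (fun i => (β i : ℝ)) ∧
    omegaVec δ B (fun i => (β i : ℝ)) ∈ d

/-- A wall is outgoing if it is not incoming. -/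
def IsOutgoing (δ : ι → ℝ) (B : Matrix ι ι ℤ) (d : Set (Module.Dual ℝ (ι → ℝ))) : Prop :=
  ¬ IsIncoming δ B d

/-- The `c`-Cambrian scattering diagram: the set of all pairs
`(Cone_c(v) ∩ β_t^⊥, 1 + ŷ^{β_t})` with `v` a `c`-sortable element and `t ∈ cov(v)`. The exponent
`m` is the coordinate vector of the positive root `β_t`, and power series in the variables
`ŷ_i` are elements of `MvPowerSeries ι 𝕜`. -/
def cambScat (𝕜 : Type*) [Field 𝕜] (B : Matrix ι ι ℤ) (c : (ι → ℝ) ≃ₗ[ℝ] (ι → ℝ)) :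
    Set (Set (Module.Dual ℝ (ι → ℝ)) × MvPowerSeries ι 𝕜) :=
  {W | ∃ v C t, ∃ m : ι →₀ ℕ, IsSortable B Finset.univ c v ∧ IsLabelSet B Finset.univ c v C ∧
    t ∈ cov B v ∧ IsReflectionWithRoot B t (fun i => (m i : ℝ)) ∧
    W = (dualCone C ∩ perp (fun i => (m i : ℝ)), 1 + MvPowerSeries.monomial m 1)}

end CambScat

end

/-! The form ω is the antisymmetrization of an Euler form. For a Coxeter element c of W_J, let E
satisfy E(x - c x, y) = K(x, y) for y in V_J. For the c determined by B,
`IsCoxeterWord.isEuler_halfForm` gives E = (K + ω)/2, so ω(x, y) = E(x, y) - E(y, x). The Euler form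
follows both branches of the recursion defining C_c(v): on V_{J∖i} the same E serves s_i c, and
E(s_i ·, s_i ·) serves s_i c s_i.

Along this recursion, `IsLabelSet.euler` shows that E(γ, η) = 0 for γ a positive and η a negative
label, and E(γ, η) ≤ 0 for distinct labels of equal sign. Since 2E(x, x) = K(x, x) > 0 for nonzero x
in V_J, each sign block behaves like an M-matrix: a nonnegative right hand side forces a nonnegative
solution. Expanding α_i in the labels then yields the key lemma `IsLabelSet.simpleRoot_mem_cone`: if
s_i is final in c and not below v, then α_i is a nonnegative combination of labels.

`IsLabelSet.exists_omega_neg` is an induction in which β or -β is a label. In a descent, β is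
replaced by s_i β. The essential case is s_i β = α_j, where a_ij < 0. If ω(·, β) were nonnegative on
all labels, the key lemma would make its pullback by s_i nonnegative on α_i; but its value there is
δ_i a_ij < 0.

For walls, the key lemma also shows (`IsLabelSet.apply_simpleRoot_mem`) that the root of a cover
reflection is a label up to a scalar. The labels form a basis of V, so the wall determines its
normal vector up to a scalar. -/

noncomputable section

set_option linter.unusedSectionVars false

namespace CambScat

variable {ι : Type*} [Fintype ι] [DecidableEq ι]

/-! ### Simple roots, simple reflections and parabolic subgroups -/

/-- The symmetric form `K` on `V` with `K(α_i, α_j) = δ_i a_ij`. -/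
def symForm (δ : ι → ℝ) (B : Matrix ι ι ℤ) : LinearMap.BilinForm ℝ (ι → ℝ) :=
  Matrix.toBilin' (Matrix.of fun i j => δ i * (cartan B i j : ℝ))

/-- The vectors `w α_i`. -/
def IsRoot (B : Matrix ι ι ℤ) (β : ι → ℝ) : Prop :=
  ∃ w ∈ weylGroup B, ∃ i, β = w (simpleRoot i)

theorem simpleRoot_apply (i j : ι) : simpleRoot i j = if j = i then (1 : ℝ) else 0 := by
  simp [simpleRoot, Pi.single_apply]

theorem simpleRoot_nonneg (i : ι) : 0 ≤ (simpleRoot i : ι → ℝ) := by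
  intro j
  rw [simpleRoot_apply]
  split_ifs <;> simp

theorem simpleRoot_ne_zero (i : ι) : (simpleRoot i : ι → ℝ) ≠ 0 := by
  intro h
  simpa [simpleRoot_apply] using congrFun h i

theorem sum_smul_simpleRoot (x : ι → ℝ) : ∑ i, x i • (simpleRoot i : ι → ℝ) = x := by
  ext j
  simp [simpleRoot_apply]

theorem corootForm_apply (B : Matrix ι ι ℤ) (i : ι) (x : ι → ℝ) :
    corootForm B i x = ∑ j, (cartan B i j : ℝ) * x j := by
  simp [corootForm]

theorem s_apply (B : Matrix ι ι ℤ) (i : ι) (x : ι → ℝ) :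
    s B i x = x - corootForm B i x • simpleRoot i := by
  rw [s, Module.reflection_apply]

theorem s_apply_of_ne (B : Matrix ι ι ℤ) {i k : ι} (h : k ≠ i) (x : ι → ℝ) :
    s B i x k = x k := by
  simp [s_apply, simpleRoot_apply, h]

theorem s_apply_self (B : Matrix ι ι ℤ) (i : ι) (x : ι → ℝ) :
    s B i x i = x i - corootForm B i x := by
  simp [s_apply, simpleRoot_apply]

theorem s_simpleRoot_self (B : Matrix ι ι ℤ) (i : ι) :
    s B i (simpleRoot i) = -simpleRoot i := by
  rw [s_apply, corootForm_self, two_smul]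
  abel

theorem s_s (B : Matrix ι ι ℤ) (i : ι) (x : ι → ℝ) : s B i (s B i x) = x := by
  rw [s_apply B i (s B i x), s_apply, map_sub, map_smul, corootForm_self, smul_eq_mul]
  module

theorem s_mul_self (B : Matrix ι ι ℤ) (i : ι) : s B i * s B i = 1 :=
  LinearEquiv.ext fun x => s_s B i x

theorem s_inv (B : Matrix ι ι ℤ) (i : ι) : (s B i)⁻¹ = s B i :=
  inv_eq_of_mul_eq_one_right (s_mul_self B i)

theorem s_mem_parabolic (B : Matrix ι ι ℤ) {J : Finset ι} {i : ι} (h : i ∈ J) :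
    s B i ∈ parabolic B J :=
  Subgroup.subset_closure ⟨i, h, rfl⟩

theorem s_mem (B : Matrix ι ι ℤ) (i : ι) : s B i ∈ weylGroup B :=
  s_mem_parabolic B (Finset.mem_univ i)

theorem parabolic_mono (B : Matrix ι ι ℤ) {J J' : Finset ι} (h : J ⊆ J') :
    parabolic B J ≤ parabolic B J' :=
  Subgroup.closure_mono (Set.image_mono (by exact_mod_cast h))

theorem parabolic_le (B : Matrix ι ι ℤ) (J : Finset ι) : parabolic B J ≤ weylGroup B :=
  parabolic_mono B (Finset.subset_univ J)

/-- A property of vectors preserved by the simple reflections of `W_J` is preserved by `W_J`. -/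
theorem parabolic_induction (B : Matrix ι ι ℤ) {J : Finset ι} (P : (ι → ℝ) → Prop)
    (h : ∀ i ∈ J, ∀ x, P x → P (s B i x)) {w : (ι → ℝ) ≃ₗ[ℝ] (ι → ℝ)}
    (hw : w ∈ parabolic B J) {x : ι → ℝ} (hx : P x) : P (w x) := by
  -- Carrying w⁻¹ along lets the closure induction pass through inverses.
  have key : (∀ x, P x → P (w x)) ∧ (∀ x, P x → P (w⁻¹ x)) := by
    refine Subgroup.closure_induction (p := fun w _ => (∀ x, P x → P (w x)) ∧
      (∀ x, P x → P (w⁻¹ x))) ?_ ?_ ?_ ?_ hw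
    · rintro _ ⟨i, hi, rfl⟩
      rw [s_inv]
      exact ⟨h i hi, h i hi⟩
    · simp
    · intro a b _ _ ha hb
      refine ⟨fun x hx => ha.1 _ (hb.1 _ hx), fun x hx => ?_⟩
      rw [mul_inv_rev]
      exact hb.2 _ (ha.2 _ hx)
    · intro a _ ha
      rw [inv_inv]
      exact ⟨ha.2, ha.1⟩
  exact key.1 x hx

theorem parabolic_apply_of_notMem (B : Matrix ι ι ℤ) {J : Finset ι}
    {w : (ι → ℝ) ≃ₗ[ℝ] (ι → ℝ)} (hw : w ∈ parabolic B J) {k : ι} (hk : k ∉ J) (x : ι → ℝ) :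
    w x k = x k :=
  parabolic_induction B (fun y => y k = x k)
    (fun i hi y hy => by rw [s_apply_of_ne B (by rintro rfl; exact hk hi), hy]) hw rfl

/-! ### The invariant form K and its positivity in finite type -/

section Form

variable {B : Matrix ι ι ℤ} {δ : ι → ℝ}

theorem cartan_self (i : ι) : cartan B i i = 2 := by simp [cartan]

theorem cartan_nonpos {i j : ι} (h : i ≠ j) : cartan B i j ≤ 0 := by simp [cartan, h]

theorem SkewSymmetrizes.cartan_symm (hδ : SkewSymmetrizes δ B) (i j : ι) :
    δ i * (cartan B i j : ℝ) = δ j * (cartan B j i : ℝ) := by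
  by_cases h : i = j
  · rw [h]
  · have h1 := congrArg abs (hδ.2 i j)
    rw [abs_neg, abs_mul, abs_mul, abs_of_pos (hδ.1 i), abs_of_pos (hδ.1 j)] at h1
    simp [cartan, h, Ne.symm h, h1]

theorem symForm_apply (x y : ι → ℝ) :
    symForm δ B x y = ∑ i, ∑ j, δ i * (cartan B i j : ℝ) * x i * y j := by
  rw [symForm, Matrix.toBilin'_apply]
  exact Finset.sum_congr rfl fun i _ => Finset.sum_congr rfl fun j _ => by
    rw [Matrix.of_apply]; ring

theorem symForm_simpleRoot_left (i : ι) (x : ι → ℝ) :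
    symForm δ B (simpleRoot i) x = δ i * corootForm B i x := by
  rw [symForm_apply, corootForm_apply, Finset.mul_sum, Finset.sum_eq_single i]
  · exact Finset.sum_congr rfl fun j _ => by simp [simpleRoot_apply]; ring
  · intro j _ hj
    simp [simpleRoot_apply, hj]
  · simp

theorem SkewSymmetrizes.symForm_comm (hδ : SkewSymmetrizes δ B) (x y : ι → ℝ) :
    symForm δ B x y = symForm δ B y x := by
  rw [symForm_apply, symForm_apply, Finset.sum_comm]
  refine Finset.sum_congr rfl fun i _ => Finset.sum_congr rfl fun j _ => ?_
  rw [hδ.cartan_symm]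
  ring

theorem SkewSymmetrizes.symForm_simpleRoot_right (hδ : SkewSymmetrizes δ B) (i : ι)
    (x : ι → ℝ) : symForm δ B x (simpleRoot i) = δ i * corootForm B i x := by
  rw [hδ.symForm_comm, symForm_simpleRoot_left]

theorem SkewSymmetrizes.symForm_s (hδ : SkewSymmetrizes δ B) (i : ι) (x y : ι → ℝ) :
    symForm δ B (s B i x) (s B i y) = symForm δ B x y := by
  simp only [s_apply, map_sub, map_smul, LinearMap.sub_apply, LinearMap.smul_apply, smul_eq_mul,
    hδ.symForm_simpleRoot_right, symForm_simpleRoot_left, corootForm_self]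
  ring

theorem SkewSymmetrizes.symForm_weylGroup (hδ : SkewSymmetrizes δ B)
    {w : (ι → ℝ) ≃ₗ[ℝ] (ι → ℝ)} (hw : w ∈ weylGroup B) (x y : ι → ℝ) :
    symForm δ B (w x) (w y) = symForm δ B x y := by
  revert x y
  refine Subgroup.closure_induction (p := fun w _ => ∀ x y,
      symForm δ B (w x) (w y) = symForm δ B x y) ?_ ?_ ?_ ?_ hw
  · rintro _ ⟨i, _, rfl⟩ x y
    exact hδ.symForm_s i x y
  · simp
  · intro a b _ _ ha hb x y
    rw [LinearEquiv.mul_apply, LinearEquiv.mul_apply, ha, hb]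
  · intro a _ ha x y
    rw [← ha (a⁻¹ x), ← LinearEquiv.mul_apply, ← LinearEquiv.mul_apply, mul_inv_cancel]
    rfl

/-- `V` carries a symmetrizer of `A` coming from a `W`-invariant inner product. -/
theorem IsFiniteType.exists_symmetrizer (hfin : IsFiniteType B) :
    ∃ d : ι → ℝ, (∀ i, 0 < d i) ∧ (∀ i j, d i * (cartan B i j : ℝ) = d j * (cartan B j i : ℝ)) ∧
      ∀ x : ι → ℝ, x ≠ 0 → 0 < ∑ i, ∑ j, d i * (cartan B i j : ℝ) * x i * x j := by
  have : Finite (weylGroup B) := hfin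
  have := Fintype.ofFinite (weylGroup B)
  -- Average the standard inner product over the finite group W.
  let F : LinearMap.BilinForm ℝ (ι → ℝ) :=
    ∑ w : weylGroup B, (Matrix.toBilin' (1 : Matrix ι ι ℝ)).comp
      (w.1 : (ι → ℝ) →ₗ[ℝ] (ι → ℝ)) (w.1 : (ι → ℝ) →ₗ[ℝ] (ι → ℝ))
  have hF : ∀ x y, F x y = ∑ w : weylGroup B, ∑ i, w.1 x i * w.1 y i := by
    intro x y
    simp [F, LinearMap.sum_apply, Matrix.toBilin'_apply', dotProduct]
  have hsymm : ∀ x y, F x y = F y x := fun x y => by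
    simp only [hF, mul_comm]
  have hpos : ∀ x, x ≠ 0 → 0 < F x x := by
    intro x hx
    rw [hF]
    refine Finset.sum_pos' (fun w _ => Finset.sum_nonneg fun i _ => mul_self_nonneg _)
      ⟨1, Finset.mem_univ _, ?_⟩
    obtain ⟨i, hi⟩ := Function.ne_iff.mp hx
    exact Finset.sum_pos' (fun i _ => mul_self_nonneg _)
      ⟨i, Finset.mem_univ _, mul_self_pos.mpr (by simpa using hi)⟩
  have hinv : ∀ i x y, F (s B i x) (s B i y) = F x y := by
    intro i x y
    rw [hF, hF]
    exact Fintype.sum_equiv (Equiv.mulRight (⟨s B i, s_mem B i⟩ : weylGroup B)) _ _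
      fun w => rfl
  have hFij : ∀ i j, F (simpleRoot i) (simpleRoot j) =
      F (simpleRoot i) (simpleRoot i) / 2 * (cartan B i j : ℝ) := by
    intro i j
    -- Invariance under s_i at the pair (α_i, α_j) forces F(α_i, α_j) = F(α_i, α_i) a_ij / 2, so
    -- F(α_i, α_i)/2 is a symmetrizer.
    have h := hinv i (simpleRoot i) (simpleRoot j)
    rw [s_simpleRoot_self, s_simpleRoot] at h
    simp only [map_sub, map_neg, map_smul, LinearMap.neg_apply, smul_eq_mul] at h
    linarith
  obtain ⟨d, hd⟩ : ∃ d : ι → ℝ, d = fun i => F (simpleRoot i) (simpleRoot i) / 2 := ⟨_, rfl⟩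
  have hFd : ∀ i j, F (simpleRoot i) (simpleRoot j) = d i * (cartan B i j : ℝ) := fun i j => by
    rw [hFij, hd]
  refine ⟨d, fun i => hd ▸ half_pos (hpos _ (simpleRoot_ne_zero i)), fun i j => ?_, fun x hx => ?_⟩
  · rw [← hFd, ← hFd, hsymm]
  · have h := hpos x hx
    rw [← sum_smul_simpleRoot x] at h
    simp only [map_sum, LinearMap.sum_apply, map_smul, LinearMap.smul_apply, smul_eq_mul,
      hFd, Finset.mul_sum] at h
    rw [Finset.sum_comm] at h
    refine h.trans_eq (Finset.sum_congr rfl fun i _ => Finset.sum_congr rfl fun j _ => ?_)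
    ring

/-- The form `K` is positive definite in finite type. -/
theorem IsFiniteType.symForm_pos (hfin : IsFiniteType B) (hδ : SkewSymmetrizes δ B)
    {x : ι → ℝ} (hx : x ≠ 0) : 0 < symForm δ B x x := by
  obtain ⟨d, hd, hdsymm, hdpos⟩ := hfin.exists_symmetrizer
  have hr : ∀ i, 0 < δ i / d i := fun i => div_pos (hδ.1 i) (hd i)
  -- The ratio δ_i/d_i agrees at i and j whenever a_ij ≠ 0, so rescaling coordinates by its square
  -- root turns the form of d into K.
  have hy : (fun i => √(δ i / d i) * x i) ≠ 0 := by
    obtain ⟨i, hi⟩ := Function.ne_iff.mp hx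
    exact Function.ne_iff.mpr ⟨i, mul_ne_zero (Real.sqrt_ne_zero'.mpr (hr i)) hi⟩
  refine (hdpos _ hy).trans_eq ?_
  rw [symForm_apply]
  refine Finset.sum_congr rfl fun i _ => Finset.sum_congr rfl fun j _ => ?_
  by_cases ha : (cartan B i j : ℝ) = 0
  · simp [ha]
  · have h1 := hδ.cartan_symm i j
    have h2 := hdsymm i j
    have hi := (hd i).ne'
    have hj := (hd j).ne'
    have h3 : δ i / d i = δ j / d j := by
      rw [div_eq_div_iff hi hj]
      refine mul_right_cancel₀ ha ?_
      calc δ i * d j * (cartan B i j : ℝ) = d j * (δ i * (cartan B i j : ℝ)) := by ring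
        _ = δ j * (d j * (cartan B j i : ℝ)) := by rw [h1]; ring
        _ = δ j * d i * (cartan B i j : ℝ) := by rw [← h2]; ring
    have h4 : √(δ i / d i) * √(δ j / d j) = δ i / d i := by
      rw [← h3, Real.mul_self_sqrt (hr i).le]
    calc d i * (cartan B i j : ℝ) * (√(δ i / d i) * x i) * (√(δ j / d j) * x j)
        = d i * (√(δ i / d i) * √(δ j / d j)) * (cartan B i j : ℝ) * x i * x j := by ring
      _ = δ i * (cartan B i j : ℝ) * x i * x j := by rw [h4, mul_div_cancel₀ _ hi]

end Form

/-! ### Roots: integrality and sign coherence -/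

section Roots

variable {B : Matrix ι ι ℤ} {δ : ι → ℝ}

theorem isRoot_simpleRoot (i : ι) : IsRoot B (simpleRoot i) := ⟨1, one_mem _, i, rfl⟩

theorem IsRoot.map {β : ι → ℝ} (hβ : IsRoot B β) {w : (ι → ℝ) ≃ₗ[ℝ] (ι → ℝ)}
    (hw : w ∈ weylGroup B) : IsRoot B (w β) := by
  obtain ⟨u, hu, i, rfl⟩ := hβ
  exact ⟨w * u, mul_mem hw hu, i, rfl⟩

theorem IsRoot.neg {β : ι → ℝ} (hβ : IsRoot B β) : IsRoot B (-β) := by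
  obtain ⟨u, hu, i, rfl⟩ := hβ
  exact ⟨u * s B i, mul_mem hu (s_mem B i), i, by
    rw [LinearEquiv.mul_apply, s_simpleRoot_self, map_neg]⟩

theorem IsRoot.ne_zero {β : ι → ℝ} (hβ : IsRoot B β) : β ≠ 0 := by
  obtain ⟨u, hu, i, rfl⟩ := hβ
  simpa using simpleRoot_ne_zero i

theorem exists_int_simpleRoot (i j : ι) : ∃ n : ℤ, (simpleRoot i : ι → ℝ) j = n := by
  rw [simpleRoot_apply]
  split_ifs
  · exact ⟨1, by simp⟩
  · exact ⟨0, by simp⟩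

/-- `W` preserves the root lattice. -/
theorem exists_int_apply {w : (ι → ℝ) ≃ₗ[ℝ] (ι → ℝ)} (hw : w ∈ weylGroup B) {x : ι → ℝ}
    (hx : ∀ j, ∃ n : ℤ, x j = n) : ∀ j, ∃ n : ℤ, w x j = n := by
  refine parabolic_induction B (fun x => ∀ j, ∃ n : ℤ, x j = n) (fun i _ x hx j => ?_) hw hx
  choose n hn using hx
  by_cases h : j = i
  · subst h
    rw [s_apply_self, corootForm_apply]
    exact ⟨n j - ∑ k, cartan B j k * n k, by simp [hn]⟩
  · exact ⟨n j, by rw [s_apply_of_ne B h, hn]⟩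

/-- `W` preserves the (rescaled) coroot lattice. -/
theorem SkewSymmetrizes.exists_int_apply (hδ : SkewSymmetrizes δ B)
    {w : (ι → ℝ) ≃ₗ[ℝ] (ι → ℝ)} (hw : w ∈ weylGroup B) {q : ℝ} {x : ι → ℝ}
    (hx : ∀ j, ∃ n : ℤ, δ j * x j = q * n) : ∀ j, ∃ n : ℤ, δ j * w x j = q * n := by
  refine parabolic_induction B (fun x => ∀ j, ∃ n : ℤ, δ j * x j = q * n)
    (fun i _ x hx j => ?_) hw hx
  choose n hn using hx
  by_cases h : j = i
  · subst h
    rw [s_apply_self, corootForm_apply]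
    refine ⟨n j - ∑ k, cartan B k j * n k, ?_⟩
    push_cast
    rw [mul_sub, mul_sub, hn, Finset.mul_sum, Finset.mul_sum]
    congr 1
    refine Finset.sum_congr rfl fun k _ => ?_
    rw [← mul_assoc, hδ.cartan_symm, mul_right_comm, hn]
    ring
  · exact ⟨n j, by rw [s_apply_of_ne B h, hn]⟩

/-- A root proportional to a simple root, with a positive factor, is that simple root. -/
theorem IsRoot.eq_simpleRoot_of_smul {β : ι → ℝ} (hβ : IsRoot B β) {i : ι} {a : ℝ} (ha : 0 ≤ a)
    (h : β = a • simpleRoot i) : β = simpleRoot i := by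
  obtain ⟨w, hw, k, rfl⟩ := hβ
  -- Both w and w⁻¹ preserve the root lattice, so the factor a is an integer with integer inverse.
  obtain ⟨n, hn⟩ := CambScat.exists_int_apply hw (exists_int_simpleRoot k) i
  obtain ⟨m, hm⟩ := CambScat.exists_int_apply (inv_mem hw) (exists_int_simpleRoot i) k
  have h1 : a = n := by
    rw [← hn, h]
    simp [simpleRoot_apply]
  have h2 : (simpleRoot k : ι → ℝ) = a • w⁻¹ (simpleRoot i) := by
    rw [← map_smul, ← h, ← LinearEquiv.mul_apply, inv_mul_cancel]
    rfl
  have h3 : (1 : ℝ) = a * m := by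
    rw [← hm]
    simpa [simpleRoot_apply] using congrFun h2 k
  rw [h1] at h3 ha
  have h4 : n * m = 1 := by exact_mod_cast h3.symm
  have h5 : n = 1 := by
    rcases Int.isUnit_iff.mp (IsUnit.of_mul_eq_one m h4) with h6 | h6
    · exact h6
    · rw [h6] at ha
      norm_num at ha
  rw [h, h1, h5]
  simp

/-- The form `K` takes values in `2qℤ` on vectors with coordinates in `ℤ`, whose coroot
coordinates are in `qℤ`. -/
theorem SkewSymmetrizes.exists_symForm_eq (hδ : SkewSymmetrizes δ B) {q : ℝ} (hq : 0 < q)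
    {x : ι → ℝ} (hx : ∀ j, ∃ n : ℤ, x j = n) (hx' : ∀ j, ∃ n : ℤ, δ j * x j = q * n) :
    ∃ n : ℤ, symForm δ B x x = 2 * q * n := by
  choose n hn using hx
  choose m hm using hx'
  have hf : ∀ i j, δ i * (cartan B i j : ℝ) * x i * x j =
      q * ((m i * cartan B i j * n j : ℤ) : ℝ) := by
    intro i j
    push_cast
    rw [← hn j, ← mul_assoc q, ← mul_assoc q, ← hm]
    ring
  have hsymm : ∀ i j, m i * cartan B i j * n j = m j * cartan B j i * n i := by
    intro i j
    have h : q * ((m i * cartan B i j * n j : ℤ) : ℝ) =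
        q * ((m j * cartan B j i * n i : ℤ) : ℝ) := by
      rw [← hf, ← hf, hδ.cartan_symm]
      ring
    exact_mod_cast mul_left_cancel₀ hq.ne' h
  -- Modulo 2 the terms at (i, j) and (j, i) cancel, and each diagonal term carries the factor a_ii
  -- = 2.
  have heven : (2 : ℤ) ∣ ∑ p : ι × ι, m p.1 * cartan B p.1 p.2 * n p.2 := by
    refine (ZMod.intCast_zmod_eq_zero_iff_dvd _ 2).mp ?_
    rw [Int.cast_sum]
    refine Finset.sum_involution (fun p _ => p.swap) ?_ ?_ ?_ ?_
    · rintro ⟨i, j⟩ _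
      rw [Prod.swap, hsymm j i]
      exact CharTwo.add_self_eq_zero _
    · rintro ⟨i, j⟩ _ hp heq
      apply hp
      have hij : j = i := congrArg Prod.fst heq
      subst hij
      refine (ZMod.intCast_zmod_eq_zero_iff_dvd _ 2).mpr ?_
      exact ⟨m j * n j, by rw [cartan_self]; ring⟩
    · simp
    · simp
  obtain ⟨k, hk⟩ := heven
  refine ⟨k, ?_⟩
  rw [symForm_apply]
  simp_rw [hf, ← Finset.mul_sum]
  rw [Fintype.sum_prod_type] at hk
  have := congrArg (Int.cast : ℤ → ℝ) hk
  push_cast at this ⊢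
  rw [this]
  ring

/-- Only off-diagonal Cartan entries contribute, and these are nonpositive. -/
theorem SkewSymmetrizes.symForm_nonpos_of_disjoint (hδ : SkewSymmetrizes δ B) {x y : ι → ℝ}
    (hx : 0 ≤ x) (hy : 0 ≤ y) (hxy : ∀ i, x i * y i = 0) : symForm δ B x y ≤ 0 := by
  rw [symForm_apply]
  refine Finset.sum_nonpos fun i _ => Finset.sum_nonpos fun j _ => ?_
  by_cases h : i = j
  · subst h
    rw [mul_assoc, hxy, mul_zero]
  · have h1 : (cartan B i j : ℝ) ≤ 0 := by exact_mod_cast cartan_nonpos h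
    have h2 : δ i * (cartan B i j : ℝ) ≤ 0 := mul_nonpos_of_nonneg_of_nonpos (hδ.1 i).le h1
    exact mul_nonpos_of_nonpos_of_nonneg (mul_nonpos_of_nonpos_of_nonneg h2 (hx i)) (hy j)

/-- In finite type, every root is positive or negative. -/
theorem IsRoot.nonneg_or_nonpos (hδ : SkewSymmetrizes δ B) (hfin : IsFiniteType B) {β : ι → ℝ}
    (hβ : IsRoot B β) : 0 ≤ β ∨ β ≤ 0 := by
  obtain ⟨w, hw, k, rfl⟩ := hβ
  obtain ⟨β, hβ⟩ : ∃ β, β = w (simpleRoot k) := ⟨_, rfl⟩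
  rw [← hβ]
  have hn : ∀ j, ∃ n : ℤ, β j = n := hβ ▸ CambScat.exists_int_apply hw (exists_int_simpleRoot k)
  have hm : ∀ j, ∃ n : ℤ, δ j * β j = δ k * n := by
    rw [hβ]
    refine hδ.exists_int_apply hw fun j => ?_
    rw [simpleRoot_apply]
    split_ifs with h
    · exact ⟨1, by simp [h]⟩
    · exact ⟨0, by simp⟩
  have hK : symForm δ B β β = 2 * δ k := by
    rw [hβ, hδ.symForm_weylGroup hw, symForm_simpleRoot_left, corootForm_self, mul_comm]
  -- A nonzero vector with coordinates 0 or ±β_j lies in both lattices, so K is at least 2δ_k on it.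
  -- If β had both signs, then β⁺ and β⁻ would each contribute 2δ_k and K(β⁺, β⁻) ≤ 0 would give
  -- K(β, β) ≥ 4δ_k, against K(β, β) = 2δ_k.
  have hbound : ∀ x : ι → ℝ, (∀ j, x j = 0 ∨ x j = β j ∨ x j = -β j) → x ≠ 0 →
      2 * δ k ≤ symForm δ B x x := by
    intro x hx hx0
    obtain ⟨n, hn⟩ := hδ.exists_symForm_eq (B := B) (hδ.1 k) (x := x)
      (fun j => by
        obtain ⟨n, hn⟩ := hn j
        rcases hx j with h | h | h
        · exact ⟨0, by simp [h]⟩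
        · exact ⟨n, by rw [h, hn]⟩
        · exact ⟨-n, by rw [h, hn]; simp⟩)
      (fun j => by
        obtain ⟨n, hn⟩ := hm j
        rcases hx j with h | h | h
        · exact ⟨0, by simp [h]⟩
        · exact ⟨n, by rw [h, hn]⟩
        · exact ⟨-n, by rw [h, mul_neg, hn]; simp⟩)
    have hpos := hfin.symForm_pos hδ hx0
    have hk := hδ.1 k
    rw [hn] at hpos ⊢
    have h1 : (0 : ℝ) < n := (mul_pos_iff_of_pos_left (by linarith)).mp hpos
    have h2 : (1 : ℝ) ≤ n := by
      have : (0 : ℤ) < n := by exact_mod_cast h1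
      exact_mod_cast this
    exact le_mul_of_one_le_right (by linarith) h2
  by_contra! hcon
  have hp : β⁺ ≠ 0 := fun h => hcon.2 (posPart_eq_zero.mp h)
  have hq : β⁻ ≠ 0 := fun h => hcon.1 (negPart_eq_zero.mp h)
  have h1 := hbound β⁺ (fun j => by
    rw [Pi.posPart_apply]
    rcases le_total 0 (β j) with h | h
    · exact Or.inr (Or.inl (posPart_eq_self.mpr h))
    · exact Or.inl (posPart_eq_zero.mpr h)) hp
  have h2 := hbound β⁻ (fun j => by
    rw [Pi.negPart_apply]
    rcases le_total 0 (β j) with h | h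
    · exact Or.inl (negPart_eq_zero.mpr h)
    · exact Or.inr (Or.inr (negPart_eq_neg.mpr h))) hq
  have h3 := hδ.symForm_nonpos_of_disjoint (posPart_nonneg β) (negPart_nonneg β) fun j => by
    rw [Pi.posPart_apply, Pi.negPart_apply]
    rcases le_total 0 (β j) with h | h
    · rw [negPart_eq_zero.mpr h, mul_zero]
    · rw [posPart_eq_zero.mpr h, zero_mul]
  have h4 : symForm δ B β β = symForm δ B β⁺ β⁺ + symForm δ B β⁻ β⁻ -
      2 * symForm δ B β⁺ β⁻ := by
    conv_lhs => rw [← posPart_sub_negPart β]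
    simp only [map_sub, LinearMap.sub_apply]
    rw [hδ.symForm_comm β⁻ β⁺]
    ring
  have hk := hδ.1 k
  linarith

/-- `s_i` permutes the positive roots other than `α_i`. -/
theorem IsRoot.s_nonneg (hδ : SkewSymmetrizes δ B) (hfin : IsFiniteType B) {β : ι → ℝ}
    (hβ : IsRoot B β) (h0 : 0 ≤ β) {i : ι} (hi : β ≠ simpleRoot i) : 0 ≤ s B i β := by
  -- Only the i-th coordinate changes, so if s_i β were nonpositive then β would be a multiple of
  -- α_i.
  refine ((hβ.map (s_mem B i)).nonneg_or_nonpos hδ hfin).resolve_right fun h => hi ?_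
  refine hβ.eq_simpleRoot_of_smul (h0 i) (funext fun j => ?_)
  by_cases hj : j = i
  · simp [simpleRoot_apply, hj]
  · have h1 := h j
    rw [s_apply_of_ne B hj] at h1
    simp [simpleRoot_apply, hj, le_antisymm h1 (h0 j)]

theorem IsRoot.s_nonpos (hδ : SkewSymmetrizes δ B) (hfin : IsFiniteType B) {β : ι → ℝ}
    (hβ : IsRoot B β) (h0 : β ≤ 0) {i : ι} (hi : β ≠ -simpleRoot i) : s B i β ≤ 0 := by
  have h := hβ.neg.s_nonneg hδ hfin (neg_nonneg.mpr h0) (i := i)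
    (fun h => hi (by rw [← h, neg_neg]))
  rwa [map_neg, neg_nonneg] at h

/-- The reflection `w s_i w⁻¹` is determined by the root `w α_i`. -/
theorem SkewSymmetrizes.conj_s_apply (hδ : SkewSymmetrizes δ B) {w : (ι → ℝ) ≃ₗ[ℝ] (ι → ℝ)}
    (hw : w ∈ weylGroup B) (i : ι) (x : ι → ℝ) :
    (w * s B i * w⁻¹) x = x - (2 * symForm δ B (w (simpleRoot i)) x /
      symForm δ B (w (simpleRoot i)) (w (simpleRoot i))) • w (simpleRoot i) := by
  have h1 : w (w⁻¹ x) = x := by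
    rw [← LinearEquiv.mul_apply, mul_inv_cancel]
    rfl
  have h2 : symForm δ B (w (simpleRoot i)) x = δ i * corootForm B i (w⁻¹ x) := by
    rw [← symForm_simpleRoot_left, ← hδ.symForm_weylGroup hw _ (w⁻¹ x), h1]
  rw [hδ.symForm_weylGroup hw, symForm_simpleRoot_left, corootForm_self, h2,
    LinearEquiv.mul_apply, LinearEquiv.mul_apply, s_apply, map_sub, map_smul, h1]
  congr 2
  have := (hδ.1 i).ne'
  field_simp

theorem SkewSymmetrizes.conj_s_eq (hδ : SkewSymmetrizes δ B) {w : (ι → ℝ) ≃ₗ[ℝ] (ι → ℝ)}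
    (hw : w ∈ weylGroup B) {i k : ι} (h : w (simpleRoot i) = simpleRoot k) :
    w * s B i * w⁻¹ = s B k := by
  refine LinearEquiv.ext fun x => ?_
  have h1 := hδ.conj_s_apply (one_mem (weylGroup B)) k x
  rw [one_mul, inv_one, mul_one] at h1
  rw [hδ.conj_s_apply hw, h, h1]
  rfl

end Roots

/-! ### Length and the exchange property -/

section Length

variable {B : Matrix ι ι ℤ} {δ : ι → ℝ}

theorem wordProd_nil : wordProd B [] = 1 := rfl

theorem wordProd_cons (i : ι) (l : List ι) : wordProd B (i :: l) = s B i * wordProd B l := by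
  simp [wordProd]

theorem wordProd_mem_parabolic {J : Finset ι} {l : List ι} (h : ∀ i ∈ l, i ∈ J) :
    wordProd B l ∈ parabolic B J := by
  refine Subgroup.list_prod_mem _ fun x hx => ?_
  obtain ⟨i, hi, rfl⟩ := List.mem_map.mp hx
  exact s_mem_parabolic B (h i hi)

theorem wordProd_append (l l' : List ι) :
    wordProd B (l ++ l') = wordProd B l * wordProd B l' := by
  simp [wordProd]

theorem wordProd_reverse (l : List ι) : wordProd B l.reverse = (wordProd B l)⁻¹ := by
  induction l with
  | nil => simp [wordProd]
  | cons i l ih =>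
    rw [List.reverse_cons, wordProd_append, ih, wordProd_cons, wordProd_cons, wordProd_nil,
      mul_one, mul_inv_rev, s_inv]

theorem exists_wordProd_eq {w : (ι → ℝ) ≃ₗ[ℝ] (ι → ℝ)} (hw : w ∈ weylGroup B) :
    ∃ l, wordProd B l = w := by
  refine Subgroup.closure_induction (p := fun w _ => ∃ l, wordProd B l = w) ?_ ?_ ?_ ?_ hw
  · rintro _ ⟨i, _, rfl⟩
    exact ⟨[i], by simp [wordProd]⟩
  · exact ⟨[], rfl⟩
  · rintro _ _ _ _ ⟨l, rfl⟩ ⟨l', rfl⟩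
    exact ⟨l ++ l', wordProd_append l l'⟩
  · rintro _ _ ⟨l, rfl⟩
    exact ⟨l.reverse, wordProd_reverse l⟩

theorem len_wordProd_le (l : List ι) : len B (wordProd B l) ≤ l.length :=
  Nat.sInf_le ⟨l, rfl, rfl⟩

theorem exists_reduced {w : (ι → ℝ) ≃ₗ[ℝ] (ι → ℝ)} (hw : w ∈ weylGroup B) :
    ∃ l, l.length = len B w ∧ wordProd B l = w := by
  obtain ⟨l, hl⟩ := exists_wordProd_eq hw
  exact Nat.sInf_mem (s := {k | ∃ l : List ι, l.length = k ∧ wordProd B l = w}) ⟨_, l, rfl, hl⟩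

theorem len_inv_le {w : (ι → ℝ) ≃ₗ[ℝ] (ι → ℝ)} (hw : w ∈ weylGroup B) :
    len B w⁻¹ ≤ len B w := by
  obtain ⟨l, hl, rfl⟩ := exists_reduced hw
  rw [← hl, ← wordProd_reverse, ← l.length_reverse]
  exact len_wordProd_le _

theorem len_inv {w : (ι → ℝ) ≃ₗ[ℝ] (ι → ℝ)} (hw : w ∈ weylGroup B) :
    len B w⁻¹ = len B w :=
  (len_inv_le hw).antisymm (by simpa using len_inv_le (inv_mem hw))

theorem mul_inv_apply_self (u v : (ι → ℝ) ≃ₗ[ℝ] (ι → ℝ)) (x : ι → ℝ) :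
    (u * v)⁻¹ x = v⁻¹ (u⁻¹ x) := by
  rw [mul_inv_rev, LinearEquiv.mul_apply]

/-- The exchange property. -/
theorem exists_wordProd_eq_reflection_mul (hδ : SkewSymmetrizes δ B) (hfin : IsFiniteType B)
    (l : List ι) {u : (ι → ℝ) ≃ₗ[ℝ] (ι → ℝ)} (hu : u ∈ weylGroup B) {i : ι}
    (h0 : 0 ≤ u (simpleRoot i)) (h : (wordProd B l)⁻¹ (u (simpleRoot i)) ≤ 0) :
    ∃ l' : List ι, l'.length + 1 = l.length ∧
      wordProd B l' = u * s B i * u⁻¹ * wordProd B l := by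
  have hroot : IsRoot B (u (simpleRoot i)) := (isRoot_simpleRoot i).map hu
  induction l generalizing u with
  | nil =>
    rw [wordProd_nil, inv_one] at h
    exact absurd (le_antisymm h h0) hroot.ne_zero
  | cons k l ih =>
    -- The root can change sign at a letter k only when it equals α_k; there the reflection deletes
    -- that letter from the word.
    by_cases hk : u (simpleRoot i) = simpleRoot k
    · refine ⟨l, rfl, ?_⟩
      rw [hδ.conj_s_eq hu hk, wordProd_cons, ← mul_assoc, s_mul_self, one_mul]
    · have hu' := mul_mem (s_mem B k) hu
      obtain ⟨l', hl', hw⟩ := ih hu' (hroot.s_nonneg hδ hfin h0 hk)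
        (by
          rw [wordProd_cons, mul_inv_apply_self, s_inv] at h
          exact h) ((isRoot_simpleRoot i).map hu')
      refine ⟨k :: l', by simp [hl'], ?_⟩
      rw [wordProd_cons, hw, wordProd_cons, mul_inv_rev, s_inv]
      simp only [mul_assoc]
      rw [← mul_assoc (s B k) (s B k), s_mul_self, one_mul]

theorem len_s_mul_lt (hδ : SkewSymmetrizes δ B) (hfin : IsFiniteType B)
    {v : (ι → ℝ) ≃ₗ[ℝ] (ι → ℝ)} (hv : v ∈ weylGroup B) {i : ι}
    (h : v⁻¹ (simpleRoot i) ≤ 0) : len B (s B i * v) < len B v := by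
  obtain ⟨l, hl, rfl⟩ := exists_reduced hv
  obtain ⟨l', hl', hw⟩ := exists_wordProd_eq_reflection_mul hδ hfin l (one_mem _)
    (simpleRoot_nonneg i) h
  rw [one_mul, inv_one, mul_one] at hw
  rw [← hl, ← hl', ← hw]
  exact Nat.lt_succ_of_le (len_wordProd_le l')

/-- With `inv_simpleRoot_nonpos`, this turns the length conditions of the Cambrian recursion into
signs of roots. -/
theorem inv_simpleRoot_nonneg (hδ : SkewSymmetrizes δ B) (hfin : IsFiniteType B)
    {v : (ι → ℝ) ≃ₗ[ℝ] (ι → ℝ)} (hv : v ∈ weylGroup B) {i : ι}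
    (h : len B v < len B (s B i * v)) : 0 ≤ v⁻¹ (simpleRoot i) :=
  (((isRoot_simpleRoot i).map (inv_mem hv)).nonneg_or_nonpos hδ hfin).resolve_right
    fun h1 => h.not_gt (len_s_mul_lt hδ hfin hv h1)

theorem inv_simpleRoot_nonpos (hδ : SkewSymmetrizes δ B) (hfin : IsFiniteType B)
    {v : (ι → ℝ) ≃ₗ[ℝ] (ι → ℝ)} (hv : v ∈ weylGroup B) {i : ι}
    (h : len B (s B i * v) < len B v) : v⁻¹ (simpleRoot i) ≤ 0 := by
  have h1 := inv_simpleRoot_nonneg hδ hfin (mul_mem (s_mem B i) hv) (i := i)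
    (by rwa [← mul_assoc, s_mul_self, one_mul])
  rwa [mul_inv_apply_self, s_inv, s_simpleRoot_self, map_neg, neg_nonneg] at h1

theorem apply_simpleRoot_nonpos (hδ : SkewSymmetrizes δ B) (hfin : IsFiniteType B)
    {v : (ι → ℝ) ≃ₗ[ℝ] (ι → ℝ)} (hv : v ∈ weylGroup B) {i : ι}
    (h : len B (v * s B i) < len B v) : v (simpleRoot i) ≤ 0 := by
  rw [← inv_inv v]
  refine inv_simpleRoot_nonpos hδ hfin (inv_mem hv) ?_
  have h1 := len_inv (mul_mem hv (s_mem B i))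
  rw [mul_inv_rev, s_inv] at h1
  rwa [h1, len_inv hv]

end Length

/-! ### Coxeter elements and their Euler forms -/

/-- `E` is the Euler form of the Coxeter element `c` of `W_J`: on `V_J` it satisfies
`E((1 - c) x, y) = K(x, y)`. -/
def IsEuler (δ : ι → ℝ) (B : Matrix ι ι ℤ) (J : Finset ι) (c : (ι → ℝ) ≃ₗ[ℝ] (ι → ℝ))
    (E : LinearMap.BilinForm ℝ (ι → ℝ)) : Prop :=
  ∀ x y : ι → ℝ, (∀ k ∉ J, y k = 0) → E (x - c x) y = symForm δ B x y

section Euler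

variable {B : Matrix ι ι ℤ} {δ : ι → ℝ} {J : Finset ι} {c : (ι → ℝ) ≃ₗ[ℝ] (ι → ℝ)}
  {E : LinearMap.BilinForm ℝ (ι → ℝ)} {i : ι}

theorem symForm_eq_sum (x y : ι → ℝ) :
    symForm δ B x y = ∑ j, x j * (δ j * corootForm B j y) := by
  conv_lhs => rw [← sum_smul_simpleRoot x]
  simp only [map_sum, map_smul, LinearMap.sum_apply, LinearMap.smul_apply, smul_eq_mul,
    symForm_simpleRoot_left]

/-- The existence of fundamental weights. -/
theorem exists_fundamentalWeight (hδ : SkewSymmetrizes δ B) (hfin : IsFiniteType B) (i : ι) :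
    ∃ x : ι → ℝ, ∀ j, corootForm B j x = if j = i then 1 else 0 := by
  -- Positive definiteness of K makes the Cartan matrix invertible.
  have hinj : Function.Injective (LinearMap.pi (corootForm B)) := by
    rw [injective_iff_map_eq_zero]
    intro x hx
    by_contra h0
    refine (hfin.symForm_pos hδ h0).ne' ?_
    rw [symForm_eq_sum]
    refine Finset.sum_eq_zero fun j _ => ?_
    have : corootForm B j x = 0 := congrFun hx j
    rw [this, mul_zero, mul_zero]
  obtain ⟨x, hx⟩ := (LinearMap.injective_iff_surjective.mp hinj) (simpleRoot i)
  exact ⟨x, fun j => by rw [← simpleRoot_apply, ← hx]; rfl⟩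

theorem IsCoxeterWord.mem_iff {l : List ι} (h : IsCoxeterWord B J c l) {k : ι} :
    k ∈ l ↔ k ∈ J := by
  rw [← h.2.1, List.mem_toFinset]

theorem IsCoxeterWord.mem_parabolic {l : List ι} (h : IsCoxeterWord B J c l) :
    c ∈ parabolic B J := by
  rw [← h.2.2]
  exact wordProd_mem_parabolic fun k hk => h.mem_iff.mp hk

theorem IsCoxeterWord.tail {l : List ι} (h : IsCoxeterWord B J c (i :: l)) :
    IsCoxeterWord B (J.erase i) (s B i * c) l := by
  obtain ⟨h1, h2, h3⟩ := h
  rw [List.nodup_cons] at h1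
  refine ⟨h1.2, ?_, ?_⟩
  · rw [← h2, List.toFinset_cons, Finset.erase_insert]
    simpa using h1.1
  · rw [← h3, wordProd_cons, ← mul_assoc, s_mul_self, one_mul]

theorem IsInitial.mem (h : IsInitial B J c i) : i ∈ J := by
  obtain ⟨l, hl⟩ := h
  exact hl.mem_iff.mp List.mem_cons_self

theorem IsInitial.isCoxeterElement (h : IsInitial B J c i) : IsCoxeterElement B J c := by
  obtain ⟨l, hl⟩ := h
  exact ⟨_, hl⟩

theorem IsInitial.erase (h : IsInitial B J c i) :
    IsCoxeterElement B (J.erase i) (s B i * c) := by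
  obtain ⟨l, hl⟩ := h
  exact ⟨l, hl.tail⟩

/-- Moving the first letter of the word to its end realizes the conjugation. -/
theorem IsInitial.conj (h : IsInitial B J c i) :
    IsCoxeterElement B J (s B i * c * s B i) := by
  obtain ⟨l, hl⟩ := h
  refine ⟨l ++ [i], ?_, ?_, ?_⟩
  · rw [List.nodup_append_comm]
    exact hl.1
  · rw [← hl.2.1]
    ext k
    simp
  · rw [wordProd_append, hl.tail.2.2, wordProd_cons, wordProd_nil, mul_one]

theorem IsCoxeterElement.sub_apply_eq_zero (h : IsCoxeterElement B J c) (x : ι → ℝ) :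
    ∀ k ∉ J, (x - c x) k = 0 := by
  obtain ⟨l, hl⟩ := h
  intro k hk
  rw [Pi.sub_apply, parabolic_apply_of_notMem B hl.mem_parabolic hk, sub_self]

theorem wordProd_apply_of_corootForm_eq_zero {l : List ι} {x : ι → ℝ}
    (h : ∀ j ∈ l, corootForm B j x = 0) : wordProd B l x = x := by
  induction l with
  | nil => rfl
  | cons k l ih =>
    rw [wordProd_cons, LinearEquiv.mul_apply, ih fun j hj => h j (List.mem_cons_of_mem _ hj),
      s_apply, h k List.mem_cons_self, zero_smul, sub_zero]

/-- For `i` initial in `c`, the fundamental weight at `i` is mapped to `α_i` by `1 - c`. -/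
theorem IsInitial.sub_apply_fundamentalWeight (h : IsInitial B J c i) {x : ι → ℝ}
    (hx : ∀ j, corootForm B j x = if j = i then 1 else 0) : x - c x = simpleRoot i := by
  obtain ⟨l, hl⟩ := h
  have hil : i ∉ l := (List.nodup_cons.mp hl.1).1
  rw [← hl.2.2, wordProd_cons, LinearEquiv.mul_apply, wordProd_apply_of_corootForm_eq_zero,
    s_apply, hx]
  · simp
  · intro j hj
    rw [hx, if_neg]
    rintro rfl
    exact hil hj

theorem apply_eq_sub (i : ι) (c : (ι → ℝ) ≃ₗ[ℝ] (ι → ℝ)) (x : ι → ℝ) :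
    c x = (s B i * c) x - corootForm B i ((s B i * c) x) • simpleRoot i := by
  rw [← s_apply, LinearEquiv.mul_apply, s_s]

/-- `1 - c` maps `V` onto `V_J`. -/
theorem IsCoxeterWord.exists_sub_apply_eq (hδ : SkewSymmetrizes δ B) (hfin : IsFiniteType B)
    {l : List ι} (h : IsCoxeterWord B J c l) {z : ι → ℝ} (hz : ∀ k ∉ J, z k = 0) :
    ∃ x, x - c x = z := by
  induction l generalizing J c z with
  | nil =>
    refine ⟨0, ?_⟩
    ext k
    rw [hz k (fun hk => by simpa using h.mem_iff.mpr hk)]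
    simp
  | cons i l ih =>
    obtain ⟨x, hx⟩ := ih h.tail (z := z - z i • simpleRoot i) (fun k hk => by
      by_cases hki : k = i
      · simp [hki, simpleRoot_apply]
      · have : k ∉ J := fun hkJ => hk (Finset.mem_erase.mpr ⟨hki, hkJ⟩)
        simp [hz k this, simpleRoot_apply, hki])
    obtain ⟨x0, hx0⟩ := exists_fundamentalWeight hδ hfin i
    have h0 := IsInitial.sub_apply_fundamentalWeight ⟨l, h⟩ hx0
    -- As (1 - c) x0 = α_i, a multiple of x0 corrects the α_i-coordinate left over from the shorter
    -- word.
    refine ⟨x + (z i - corootForm B i ((s B i * c) x)) • x0, ?_⟩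
    calc x + (z i - corootForm B i ((s B i * c) x)) • x0 -
          c (x + (z i - corootForm B i ((s B i * c) x)) • x0)
        = (x - c x) + (z i - corootForm B i ((s B i * c) x)) • (x0 - c x0) := by
          rw [map_add, map_smul]; module
      _ = (x - (s B i * c) x) + z i • simpleRoot i := by
          rw [h0, apply_eq_sub i c x]; module
      _ = z := by rw [hx, sub_add_cancel]

theorem IsCoxeterElement.exists_sub_apply_eq (hδ : SkewSymmetrizes δ B) (hfin : IsFiniteType B)
    (h : IsCoxeterElement B J c) {z : ι → ℝ} (hz : ∀ k ∉ J, z k = 0) : ∃ x, x - c x = z := by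
  obtain ⟨l, hl⟩ := h
  exact hl.exists_sub_apply_eq hδ hfin hz

theorem IsCoxeterElement.symForm_apply (hδ : SkewSymmetrizes δ B) (h : IsCoxeterElement B J c)
    (x y : ι → ℝ) : symForm δ B (c x) (c y) = symForm δ B x y := by
  obtain ⟨l, hl⟩ := h
  exact hδ.symForm_weylGroup (parabolic_le B J hl.mem_parabolic) x y

/-- The symmetrization of the Euler form is `K`. -/
theorem IsEuler.add_flip (hδ : SkewSymmetrizes δ B) (hfin : IsFiniteType B)
    (hE : IsEuler δ B J c E) (hc : IsCoxeterElement B J c) {x y : ι → ℝ}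
    (hx : ∀ k ∉ J, x k = 0) (hy : ∀ k ∉ J, y k = 0) : E x y + E y x = symForm δ B x y := by
  -- Once both arguments are in the image of 1 - c, the identity reduces to the c-invariance of K.
  obtain ⟨u, rfl⟩ := hc.exists_sub_apply_eq hδ hfin hx
  obtain ⟨v, rfl⟩ := hc.exists_sub_apply_eq hδ hfin hy
  rw [hE u _ hy, hE v _ hx]
  simp only [map_sub, LinearMap.sub_apply, hc.symForm_apply hδ]
  rw [hδ.symForm_comm v u, hδ.symForm_comm v (c u)]
  ring

/-- For the fundamental weight x at i, (1 - c) x = α_i and K(x, y) = δ_i y_i. -/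
theorem IsEuler.initial (hδ : SkewSymmetrizes δ B) (hfin : IsFiniteType B)
    (hE : IsEuler δ B J c E) (hi : IsInitial B J c i) {y : ι → ℝ} (hy : ∀ k ∉ J, y k = 0) :
    E (simpleRoot i) y = δ i * y i := by
  obtain ⟨x, hx⟩ := exists_fundamentalWeight hδ hfin i
  rw [← hi.sub_apply_fundamentalWeight hx, hE x y hy, hδ.symForm_comm, symForm_eq_sum]
  simp [hx, mul_comm]

/-- The vectors c x and s_i c x differ by a multiple of α_i, and E(α_i, y) = δ_i y_i vanishes on
V_{J∖i}. -/
theorem IsEuler.erase (hδ : SkewSymmetrizes δ B) (hfin : IsFiniteType B)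
    (hE : IsEuler δ B J c E) (hi : IsInitial B J c i) :
    IsEuler δ B (J.erase i) (s B i * c) E := by
  intro x y hy
  have hy' : ∀ k ∉ J, y k = 0 := fun k hk => hy k fun h => hk (Finset.mem_of_mem_erase h)
  have hyi : y i = 0 := hy i (Finset.notMem_erase i J)
  rw [← hE x y hy', apply_eq_sub (B := B) i c x]
  simp only [map_sub, map_smul, LinearMap.sub_apply, LinearMap.smul_apply,
    hE.initial hδ hfin hi hy', hyi]
  simp

/-- The form `E(s_i x, s_i y)`. -/
def conjForm (B : Matrix ι ι ℤ) (i : ι) (E : LinearMap.BilinForm ℝ (ι → ℝ)) :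
    LinearMap.BilinForm ℝ (ι → ℝ) :=
  E.compl₁₂ (s B i : (ι → ℝ) →ₗ[ℝ] (ι → ℝ)) (s B i : (ι → ℝ) →ₗ[ℝ] (ι → ℝ))

theorem conjForm_apply (x y : ι → ℝ) : conjForm B i E x y = E (s B i x) (s B i y) := rfl

theorem s_apply_eq_zero (hi : i ∈ J) {x : ι → ℝ} (hx : ∀ k ∉ J, x k = 0) :
    ∀ k ∉ J, s B i x k = 0 := fun k hk => by
  rw [s_apply_of_ne B (by rintro rfl; exact hk hi), hx k hk]

theorem simpleRoot_eq_zero (hi : i ∈ J) : ∀ k ∉ J, (simpleRoot i : ι → ℝ) k = 0 :=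
  fun k hk => by rw [simpleRoot_apply, if_neg (by rintro rfl; exact hk hi)]

/-- s_i(x - s_i c s_i x) = s_i x - c(s_i x), and K is invariant under s_i. -/
theorem IsEuler.conj (hδ : SkewSymmetrizes δ B) (hE : IsEuler δ B J c E) (hi : i ∈ J) :
    IsEuler δ B J (s B i * c * s B i) (conjForm B i E) := by
  intro x y hy
  rw [conjForm_apply, map_sub, LinearEquiv.mul_apply, LinearEquiv.mul_apply, s_s,
    hE _ _ (s_apply_eq_zero hi hy), hδ.symForm_s]

/-- s_i is final in s_i c s_i, so this is `IsEuler.initial` with the two arguments exchanged; it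
follows from the symmetrization of E being K. -/
theorem IsEuler.conj_final (hδ : SkewSymmetrizes δ B) (hfin : IsFiniteType B)
    (hE : IsEuler δ B J c E) (hi : IsInitial B J c i) {x : ι → ℝ} (hx : ∀ k ∉ J, x k = 0) :
    conjForm B i E x (simpleRoot i) = δ i * x i := by
  have hsx := s_apply_eq_zero (B := B) hi.mem hx
  have h1 := hE.add_flip hδ hfin hi.isCoxeterElement hsx (simpleRoot_eq_zero hi.mem)
  have h2 : corootForm B i (s B i x) = -corootForm B i x := by
    rw [s_apply, map_sub, map_smul, corootForm_self, smul_eq_mul]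
    ring
  rw [hE.initial hδ hfin hi hsx, s_apply_self, hδ.symForm_simpleRoot_right, h2] at h1
  rw [conjForm_apply, s_simpleRoot_self, map_neg]
  linarith

/-- Strip initial letters until j or k comes first: the value is 0 in the first case and K(α_j, α_k)
in the second. -/
theorem IsCoxeterWord.euler_simpleRoot_nonpos (hδ : SkewSymmetrizes δ B)
    (hfin : IsFiniteType B) {l : List ι} (h : IsCoxeterWord B J c l) (hE : IsEuler δ B J c E)
    {j k : ι} (hj : j ∈ J) (hk : k ∈ J) (hjk : j ≠ k) :
    E (simpleRoot j) (simpleRoot k) ≤ 0 := by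
  induction l generalizing J c with
  | nil => simp [← h.mem_iff] at hj
  | cons i l ih =>
    have hi : IsInitial B J c i := ⟨l, h⟩
    by_cases hji : j = i
    · subst hji
      rw [hE.initial hδ hfin hi (simpleRoot_eq_zero hk), simpleRoot_apply, if_neg hjk, mul_zero]
    by_cases hki : k = i
    · subst hki
      have h1 := hE.add_flip hδ hfin hi.isCoxeterElement (simpleRoot_eq_zero hj)
        (simpleRoot_eq_zero hk)
      rw [hE.initial hδ hfin hi (simpleRoot_eq_zero hj), simpleRoot_apply, if_neg (Ne.symm hjk),
        mul_zero, add_zero, symForm_simpleRoot_left, corootForm_simpleRoot] at h1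
      rw [h1]
      exact mul_nonpos_of_nonneg_of_nonpos (hδ.1 j).le (by exact_mod_cast cartan_nonpos hjk)
    · exact ih h.tail (hE.erase hδ hfin hi) (Finset.mem_erase.mpr ⟨hji, hj⟩)
        (Finset.mem_erase.mpr ⟨hki, hk⟩)

/-! ### The Euler form of the Coxeter element determined by B -/

theorem omega_apply (x y : ι → ℝ) :
    omega δ B x y = ∑ i, ∑ j, δ i * (B i j : ℝ) * x i * y j := by
  rw [omega, Matrix.toBilin'_apply]
  exact Finset.sum_congr rfl fun i _ => Finset.sum_congr rfl fun j _ => by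
    rw [Matrix.of_apply]; ring

theorem SkewSymmetrizes.omega_neg (hδ : SkewSymmetrizes δ B) (x y : ι → ℝ) :
    omega δ B x y = -omega δ B y x := by
  rw [omega_apply, omega_apply, Finset.sum_comm, ← Finset.sum_neg_distrib]
  refine Finset.sum_congr rfl fun i _ => ?_
  rw [← Finset.sum_neg_distrib]
  refine Finset.sum_congr rfl fun j _ => ?_
  rw [hδ.2]
  ring

/-- The form `(K + ω) / 2`. -/
def halfForm (δ : ι → ℝ) (B : Matrix ι ι ℤ) : LinearMap.BilinForm ℝ (ι → ℝ) :=
  (1 / 2 : ℝ) • (symForm δ B + omega δ B)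

theorem halfForm_apply (x y : ι → ℝ) :
    halfForm δ B x y = (1 / 2) * (symForm δ B x y + omega δ B x y) := rfl

/-- Over the support of y, a_ij = -b_ij for j ≠ i, so K and ω cancel except in the diagonal term. -/
theorem SkewSymmetrizes.halfForm_simpleRoot_left (hδ : SkewSymmetrizes δ B) {y : ι → ℝ}
    (h : ∀ j, j ≠ i → y j ≠ 0 → ¬ 0 < B j i) : halfForm δ B (simpleRoot i) y = δ i * y i := by
  have hω : omega δ B (simpleRoot i) y = ∑ j, δ i * (B i j : ℝ) * y j := by
    rw [omega_apply, Finset.sum_eq_single i]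
    · exact Finset.sum_congr rfl fun j _ => by rw [simpleRoot_apply, if_pos rfl, mul_one]
    · intro j _ hj
      simp [simpleRoot_apply, hj]
    · simp
  rw [halfForm_apply, hω, symForm_simpleRoot_left, corootForm_apply, Finset.mul_sum,
    ← Finset.sum_add_distrib, Finset.sum_eq_single i]
  · have h1 : (B i i : ℝ) = 0 := by
      have h2 := hδ.2 i i
      have h3 : δ i * (B i i : ℝ) = 0 := by linarith
      exact (mul_eq_zero.mp h3).resolve_left (hδ.1 i).ne'
    rw [h1, cartan_self]
    push_cast
    ring
  · intro j _ hji
    by_cases hy : y j = 0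
    · simp [hy]
    · have h1 : (B j i : ℝ) ≤ 0 := by exact_mod_cast not_lt.mp (h j hji hy)
      have h2 : 0 ≤ δ i * (B i j : ℝ) := by
        rw [hδ.2, ← mul_neg]
        exact mul_nonneg (hδ.1 j).le (neg_nonneg.mpr h1)
      have h3 : (0 : ℝ) ≤ B i j := nonneg_of_mul_nonneg_right h2 (hδ.1 i)
      have h4 : (cartan B i j : ℝ) = -(B i j : ℝ) := by
        simp [cartan, Ne.symm hji, abs_of_nonneg h3]
      rw [h4]
      ring
  · simp

/-- `(K + ω) / 2` is the Euler form of the Coxeter element determined by `B`. -/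
theorem IsCoxeterWord.isEuler_halfForm (hδ : SkewSymmetrizes δ B) {l : List ι}
    (h : IsCoxeterWord B J c l) (hl : l.Pairwise (fun i j => ¬ 0 < B j i)) :
    IsEuler δ B J c (halfForm δ B) := by
  induction l generalizing J c with
  | nil =>
    intro x y hy
    have : y = 0 := funext fun k => hy k (fun hk => by simpa using h.mem_iff.mpr hk)
    simp [this]
  | cons i l ih =>
    rw [List.pairwise_cons] at hl
    intro x y hy
    have hleft : ∀ y : ι → ℝ, (∀ k ∉ J, y k = 0) →
        halfForm δ B (simpleRoot i) y = δ i * y i := fun y hy =>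
      hδ.halfForm_simpleRoot_left fun j hji hj => hl.1 j (by
        have hjJ : j ∈ J := by
          by_contra hjJ
          exact hj (hy j hjJ)
        exact (List.mem_cons.mp (h.mem_iff.mpr hjJ)).resolve_left hji)
    -- Here x - c x is x - u plus a multiple of α_i. The induction hypothesis covers y without its
    -- α_i part; that part is settled by E(α_i, x - u) = δ_i (x - u)_i = 0 and the symmetrization of
    -- E.
    obtain ⟨u, hu⟩ : ∃ u, u = (s B i * c) x := ⟨_, rfl⟩
    have hz := IsCoxeterElement.sub_apply_eq_zero ⟨l, h.tail⟩ x
    have hzi : (x - u) i = 0 := by rw [hu, hz i (Finset.notMem_erase i J)]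
    have hzJ : ∀ k ∉ J, (x - u) k = 0 := fun k hk => by
      rw [hu, hz k fun h => hk (Finset.mem_of_mem_erase h)]
    have hih := ih h.tail hl.2 x (y - y i • simpleRoot i) (fun k hk => by
      by_cases hki : k = i
      · simp [hki, simpleRoot_apply]
      · have : k ∉ J := fun hkJ => hk (Finset.mem_erase.mpr ⟨hki, hkJ⟩)
        simp [hy k this, simpleRoot_apply, hki])
    have h1 : halfForm δ B (x - u) (simpleRoot i) = δ i * corootForm B i (x - u) := by
      have h2 := hleft (x - u) hzJ
      rw [hzi, mul_zero, halfForm_apply, hδ.omega_neg, hδ.symForm_comm] at h2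
      rw [halfForm_apply, ← hδ.symForm_simpleRoot_right]
      linarith
    have h3 := apply_eq_sub (B := B) i c x
    rw [← hu] at hih h3
    have h4 : x - c x = (x - u) + corootForm B i u • simpleRoot i := by rw [h3]; abel
    rw [(halfForm δ B (x - u)).map_sub, (halfForm δ B (x - u)).map_smul, h1,
      (symForm δ B x).map_sub, (symForm δ B x).map_smul, hδ.symForm_simpleRoot_right,
      (corootForm B i).map_sub] at hih
    rw [h4, map_add, map_smul, LinearMap.add_apply, LinearMap.smul_apply, hleft y hy]
    simp only [smul_eq_mul] at hih ⊢
    linarith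

end Euler

/-! ### A positivity lemma for M-matrix-like systems -/

/-- The solution of a linear system with nonpositive off-diagonal entries and positive definite
(not necessarily symmetric) matrix is nonnegative if the right hand side is. -/
theorem sum_smul_eq_sum_posPart_smul {V : Type*} [AddCommGroup V] [Module ℝ V]
    (F : LinearMap.BilinForm ℝ V) (S : Finset V) (a : V → ℝ)
    (hF : ∀ γ ∈ S, ∀ η ∈ S, γ ≠ η → F γ η ≤ 0)
    (hpos : ∀ b : V → ℝ, F (∑ γ ∈ S, b γ • γ) (∑ γ ∈ S, b γ • γ) ≤ 0 → ∑ γ ∈ S, b γ • γ = 0)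
    (h : ∀ γ ∈ S, 0 ≤ F γ (∑ η ∈ S, a η • η)) :
    ∑ γ ∈ S, a γ • γ = ∑ γ ∈ S, (a γ)⁺ • γ := by
  -- Let x be the sum, split as x⁺ - x⁻ along a = a⁺ - a⁻. Then 0 ≤ F(x⁻, x) and F(x⁻, x⁺) ≤ 0 give
  -- F(x⁻, x⁻) ≤ 0, so x⁻ = 0. Comparing sums and not coefficients avoids linear independence.
  have hsub : ∑ γ ∈ S, a γ • γ = ∑ γ ∈ S, (a γ)⁺ • γ - ∑ γ ∈ S, (a γ)⁻ • γ := by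
    rw [← Finset.sum_sub_distrib]
    exact Finset.sum_congr rfl fun γ _ => by rw [← sub_smul, posPart_sub_negPart]
  have h1 : 0 ≤ F (∑ γ ∈ S, (a γ)⁻ • γ) (∑ γ ∈ S, a γ • γ) := by
    rw [LinearMap.map_sum₂]
    refine Finset.sum_nonneg fun γ hγ => ?_
    rw [map_smul, LinearMap.smul_apply, smul_eq_mul]
    exact mul_nonneg (negPart_nonneg _) (h γ hγ)
  have h2 : F (∑ γ ∈ S, (a γ)⁻ • γ) (∑ γ ∈ S, (a γ)⁺ • γ) ≤ 0 := by
    rw [LinearMap.map_sum₂]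
    refine Finset.sum_nonpos fun γ hγ => ?_
    rw [map_sum]
    refine Finset.sum_nonpos fun η hη => ?_
    rw [map_smul, map_smul, LinearMap.smul_apply, smul_eq_mul, smul_eq_mul, ← mul_assoc]
    by_cases hγη : γ = η
    · subst hγη
      rcases le_total 0 (a γ) with h0 | h0
      · rw [negPart_eq_zero.mpr h0]; simp
      · rw [posPart_eq_zero.mpr h0]; simp
    · exact mul_nonpos_of_nonneg_of_nonpos (mul_nonneg (posPart_nonneg _) (negPart_nonneg _))
        (hF γ hγ η hη hγη)
  have h3 := hpos (fun γ => (a γ)⁻) (by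
    rw [hsub, map_sub] at h1
    linarith)
  rw [hsub, h3, sub_zero]

/-! ### Label sets: bases, signs and the Euler form -/

section LabelSet

variable {B : Matrix ι ι ℤ} {δ : ι → ℝ} {J : Finset ι} {c v : (ι → ℝ) ≃ₗ[ℝ] (ι → ℝ)}
  {C : Set (ι → ℝ)} {E : LinearMap.BilinForm ℝ (ι → ℝ)} {i : ι}

theorem IsLabelSet.mem_parabolic (h : IsLabelSet B J c v C) : v ∈ parabolic B J := by
  induction h with
  | one J c hc => exact one_mem _
  | descent J c v i C hi hl h ih =>
    have h1 := mul_mem (s_mem_parabolic B hi.mem) ih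
    rwa [← mul_assoc, s_mul_self, one_mul] at h1
  | ascent J c v i C hi hl h ih => exact parabolic_mono B (Finset.erase_subset i J) ih

theorem IsLabelSet.mem_weylGroup (h : IsLabelSet B J c v C) : v ∈ weylGroup B :=
  parabolic_le B J h.mem_parabolic

theorem IsLabelSet.isCoxeterElement (h : IsLabelSet B J c v C) : IsCoxeterElement B J c := by
  cases h with
  | one J c hc => exact hc
  | descent J c v i C hi hl h => exact hi.isCoxeterElement
  | ascent J c v i C hi hl h => exact hi.isCoxeterElement

theorem IsLabelSet.isRoot (h : IsLabelSet B J c v C) {γ : ι → ℝ} (hγ : γ ∈ C) : IsRoot B γ := by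
  induction h generalizing γ with
  | one J c hc =>
    obtain ⟨j, _, rfl⟩ := hγ
    exact isRoot_simpleRoot j
  | descent J c v i C hi hl h ih =>
    obtain ⟨η, hη, rfl⟩ := hγ
    exact (ih hη).map (s_mem B i)
  | ascent J c v i C hi hl h ih =>
    rcases hγ with rfl | hγ
    · exact isRoot_simpleRoot i
    · exact ih hγ

theorem IsLabelSet.eq_zero (h : IsLabelSet B J c v C) {γ : ι → ℝ} (hγ : γ ∈ C) :
    ∀ k ∉ J, γ k = 0 := by
  induction h generalizing γ with
  | one J c hc =>
    obtain ⟨j, hj, rfl⟩ := hγ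
    exact simpleRoot_eq_zero hj
  | descent J c v i C hi hl h ih =>
    obtain ⟨η, hη, rfl⟩ := hγ
    exact s_apply_eq_zero hi.mem (ih hη)
  | ascent J c v i C hi hl h ih =>
    rcases hγ with rfl | hγ
    · exact simpleRoot_eq_zero hi.mem
    · exact fun k hk => ih hγ k fun h => hk (Finset.mem_of_mem_erase h)

/-- The cone of `v` contains the chamber of `v`. -/
theorem IsLabelSet.inv_apply_nonneg (hδ : SkewSymmetrizes δ B) (hfin : IsFiniteType B)
    (h : IsLabelSet B J c v C) {γ : ι → ℝ} (hγ : γ ∈ C) : 0 ≤ v⁻¹ γ := by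
  induction h generalizing γ with
  | one J c hc =>
    obtain ⟨j, _, rfl⟩ := hγ
    rw [inv_one]
    exact simpleRoot_nonneg j
  | descent J c v i C hi hl h ih =>
    obtain ⟨η, hη, rfl⟩ := hγ
    have h1 := ih hη
    rwa [mul_inv_apply_self, s_inv] at h1
  | ascent J c v i C hi hl h ih =>
    rcases hγ with rfl | hγ
    · exact inv_simpleRoot_nonneg hδ hfin h.mem_weylGroup hl
    · exact ih hγ

/-- With `IsLabelSet.linearIndepOn`, this makes C_c(v) a basis of V_J. -/
theorem IsLabelSet.mem_span (h : IsLabelSet B J c v C) {z : ι → ℝ} (hz : ∀ k ∉ J, z k = 0) :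
    z ∈ Submodule.span ℝ C := by
  induction h generalizing z with
  | one J c hc =>
    rw [← sum_smul_simpleRoot z]
    refine Submodule.sum_mem _ fun j _ => ?_
    by_cases hj : j ∈ J
    · exact Submodule.smul_mem _ _ (Submodule.subset_span ⟨j, hj, rfl⟩)
    · rw [hz j hj, zero_smul]
      exact Submodule.zero_mem _
  | descent J c v i C hi hl h ih =>
    have h1 := Submodule.mem_map_of_mem (f := (s B i : (ι → ℝ) →ₗ[ℝ] (ι → ℝ)))
      (ih (s_apply_eq_zero (B := B) hi.mem hz))
    rw [Submodule.map_span] at h1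
    have h2 : (s B i : (ι → ℝ) →ₗ[ℝ] (ι → ℝ)) (s B i z) = z := s_s B i z
    rwa [h2] at h1
  | ascent J c v i C hi hl h ih =>
    have h1 := ih (z := z - z i • simpleRoot i) (fun k hk => by
      by_cases hki : k = i
      · simp [hki, simpleRoot_apply]
      · have : k ∉ J := fun hkJ => hk (Finset.mem_erase.mpr ⟨hki, hkJ⟩)
        simp [hz k this, simpleRoot_apply, hki])
    have h2 : z = (z - z i • simpleRoot i) + z i • simpleRoot i := by abel
    rw [h2]
    exact add_mem (Submodule.span_mono (Set.subset_insert _ _) h1)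
      (Submodule.smul_mem _ _ (Submodule.subset_span (Set.mem_insert _ _)))

theorem linearIndependent_simpleRoot : LinearIndependent ℝ (simpleRoot : ι → ι → ℝ) := by
  have h := (Pi.basisFun ℝ ι).linearIndependent
  have h1 : ⇑(Pi.basisFun ℝ ι) = simpleRoot := by
    ext i j
    simp [simpleRoot]
  rwa [h1] at h

/-- Reflections preserve independence, and an ascent adds α_i to labels whose i-th coordinate is
zero. -/
theorem IsLabelSet.linearIndepOn (h : IsLabelSet B J c v C) : LinearIndepOn ℝ id C := by
  induction h with
  | one J c hc =>
    exact (linearIndependent_simpleRoot.linearIndepOn_id).mono (Set.image_subset_range _ _)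
  | descent J c v i C hi hl h ih =>
    exact LinearIndepOn.image (f := (s B i : (ι → ℝ) →ₗ[ℝ] (ι → ℝ))) ih (by simp)
  | ascent J c v i C hi hl h ih =>
    refine ih.id_insert fun hmem => ?_
    have h1 : ∀ z ∈ Submodule.span ℝ C, z i = 0 := fun z hz =>
      (Submodule.span_le (p := LinearMap.ker (LinearMap.proj i : (ι → ℝ) →ₗ[ℝ] ℝ))).mpr
        (fun γ hγ => h.eq_zero hγ i (Finset.notMem_erase i J)) hz
    simpa [simpleRoot_apply] using h1 _ hmem

/-- The Euler form on the labels: it vanishes between positive and negative labels, and is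
nonpositive on distinct labels of the same sign. -/
theorem IsLabelSet.euler (hδ : SkewSymmetrizes δ B) (hfin : IsFiniteType B)
    (h : IsLabelSet B J c v C) (hE : IsEuler δ B J c E) :
    (∀ γ ∈ C, ∀ η ∈ C, 0 ≤ γ → η ≤ 0 → E γ η = 0) ∧
    (∀ γ ∈ C, ∀ η ∈ C, γ ≠ η → 0 ≤ γ → 0 ≤ η → E γ η ≤ 0) ∧
    (∀ γ ∈ C, ∀ η ∈ C, γ ≠ η → γ ≤ 0 → η ≤ 0 → E γ η ≤ 0) := by
  have hsimple : ∀ j, ¬ (simpleRoot j : ι → ℝ) ≤ 0 := fun j hj =>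
    simpleRoot_ne_zero j (le_antisymm hj (simpleRoot_nonneg j))
  induction h generalizing E with
  | one J c hc =>
    refine ⟨?_, ?_, ?_⟩
    · rintro _ _ _ ⟨k, hk, rfl⟩ _ hneg
      exact absurd hneg (hsimple k)
    · rintro _ ⟨j, hj, rfl⟩ _ ⟨k, hk, rfl⟩ hjk _ _
      obtain ⟨l, hl⟩ := hc
      exact hl.euler_simpleRoot_nonpos hδ hfin hE hj hk (by rintro rfl; exact hjk rfl)
    · rintro _ _ _ ⟨k, hk, rfl⟩ _ _ hneg
      exact absurd hneg (hsimple k)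
  | descent J c v i C hi hl h ih =>
    obtain ⟨ih1, ih2, ih3⟩ := ih (hE.conj hδ hi.mem)
    have hfinal : ∀ x ∈ C, conjForm B i E x (simpleRoot i) = δ i * x i := fun x hx =>
      hE.conj_final hδ hfin hi (h.eq_zero hx)
    -- The chamber of s_i v excludes -α_i as a label, so the only label whose sign s_i can change is
    -- α_i, from positive to negative.
    have hnot : ∀ x ∈ C, x ≠ -simpleRoot i := by
      rintro x hx rfl
      have h1 := h.inv_apply_nonneg hδ hfin hx
      have h2 := inv_simpleRoot_nonneg hδ hfin h.mem_weylGroup (i := i)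
        (by rwa [← mul_assoc, s_mul_self, one_mul])
      rw [map_neg, Left.nonneg_neg_iff] at h1
      exact ((isRoot_simpleRoot i).map (inv_mem h.mem_weylGroup)).ne_zero (le_antisymm h1 h2)
    have hpos : ∀ x ∈ C, 0 ≤ s B i x → 0 ≤ x := fun x hx h0 => by
      refine ((h.isRoot hx).nonneg_or_nonpos hδ hfin).resolve_right fun h1 => ?_
      exact ((h.isRoot hx).map (s_mem B i)).ne_zero
        (le_antisymm ((h.isRoot hx).s_nonpos hδ hfin h1 (hnot x hx)) h0)
    have hneg : ∀ x ∈ C, s B i x ≤ 0 → x ≤ 0 ∨ x = simpleRoot i := fun x hx h0 => by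
      rcases (h.isRoot hx).nonneg_or_nonpos hδ hfin with h1 | h1
      · by_contra! h2
        exact ((h.isRoot hx).map (s_mem B i)).ne_zero
          (le_antisymm h0 ((h.isRoot hx).s_nonneg hδ hfin h1 h2.2))
      · exact Or.inl h1
    refine ⟨?_, ?_, ?_⟩
    · rintro _ ⟨x, hx, rfl⟩ _ ⟨y, hy, rfl⟩ hx0 hy0
      rw [← conjForm_apply]
      have hx1 := hpos x hx hx0
      rcases hneg y hy hy0 with hy1 | rfl
      · exact ih1 x hx y hy hx1 hy1
      · have hne : x ≠ simpleRoot i := by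
          rintro rfl
          rw [s_simpleRoot_self, Left.nonneg_neg_iff] at hx0
          exact hsimple i hx0
        -- Before the reflection both labels are positive, so the value is at most 0; finality of
        -- s_i makes it δ_i x_i ≥ 0.
        refine le_antisymm (ih2 x hx _ hy hne hx1 (simpleRoot_nonneg i)) ?_
        rw [hfinal x hx]
        exact mul_nonneg (hδ.1 i).le (hx1 i)
    · rintro _ ⟨x, hx, rfl⟩ _ ⟨y, hy, rfl⟩ hne hx0 hy0
      rw [← conjForm_apply]
      exact ih2 x hx y hy (by rintro rfl; exact hne rfl) (hpos x hx hx0) (hpos y hy hy0)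
    · rintro _ ⟨x, hx, rfl⟩ _ ⟨y, hy, rfl⟩ hne hx0 hy0
      rw [← conjForm_apply]
      have hne' : x ≠ y := by rintro rfl; exact hne rfl
      rcases hneg x hx hx0 with hx1 | rfl <;> rcases hneg y hy hy0 with hy1 | rfl
      · exact ih3 x hx y hy hne' hx1 hy1
      · rw [hfinal x hx]
        exact mul_nonpos_of_nonneg_of_nonpos (hδ.1 i).le (hx1 i)
      · exact (ih1 _ hx y hy (simpleRoot_nonneg i) hy1).le
      · exact absurd rfl hne'
  | ascent J c v i C hi hl h ih =>
    obtain ⟨ih1, ih2, ih3⟩ := ih (hE.erase hδ hfin hi)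
    have hsupp : ∀ x ∈ C, ∀ k ∉ J, x k = 0 := fun x hx k hk =>
      h.eq_zero hx k fun h => hk (Finset.mem_of_mem_erase h)
    have hleft : ∀ x ∈ C, E (simpleRoot i) x = 0 := fun x hx => by
      rw [hE.initial hδ hfin hi (hsupp x hx), h.eq_zero hx i (Finset.notMem_erase i J), mul_zero]
    refine ⟨?_, ?_, ?_⟩
    · rintro x (rfl | hx) y (rfl | hy) hx0 hy0
      · exact absurd hy0 (hsimple i)
      · exact hleft y hy
      · exact absurd hy0 (hsimple i)
      · exact ih1 x hx y hy hx0 hy0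
    · rintro x (rfl | hx) y (rfl | hy) hne hx0 hy0
      · exact absurd rfl hne
      · exact (hleft y hy).le
      -- As E(α_i, x) = 0, the value is K(x, α_i), with x and α_i of disjoint support.
      · have h1 := hE.add_flip hδ hfin hi.isCoxeterElement (hsupp x hx)
          (simpleRoot_eq_zero hi.mem)
        rw [hleft x hx, add_zero] at h1
        rw [h1]
        refine hδ.symForm_nonpos_of_disjoint hx0 hy0 fun k => ?_
        by_cases hk : k = i
        · rw [hk, h.eq_zero hx i (Finset.notMem_erase i J), zero_mul]
        · rw [simpleRoot_apply, if_neg hk, mul_zero]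
      · exact ih2 x hx y hy hne hx0 hy0
    · rintro x (rfl | hx) y (rfl | hy) hne hx0 hy0
      · exact absurd rfl hne
      · exact absurd hx0 (hsimple i)
      · exact absurd hy0 (hsimple i)
      · exact ih3 x hx y hy hne hx0 hy0

/-! ### The cone lemma and its consequences -/

/-- If `s_i` is final in `c` and not below `v`, then `α_i` is in the cone spanned by `C_c(v)`. -/
theorem IsLabelSet.simpleRoot_mem_cone (hδ : SkewSymmetrizes δ B) (hfin : IsFiniteType B)
    (h : IsLabelSet B J c v C) (hE : IsEuler δ B J c E) (hi : i ∈ J)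
    (hfinal : ∀ x : ι → ℝ, (∀ k ∉ J, x k = 0) → E x (simpleRoot i) = δ i * x i)
    (hv : 0 ≤ v⁻¹ (simpleRoot i)) :
    ∃ (a : (ι → ℝ) → ℝ) (S : Finset (ι → ℝ)), ↑S ⊆ C ∧ (∀ γ, 0 ≤ a γ) ∧
      ∑ γ ∈ S, a γ • γ = simpleRoot i := by
  classical
  obtain ⟨h1, h2, h3⟩ := h.euler hδ hfin hE
  obtain ⟨a, S, hSC, -, hsum⟩ := Submodule.mem_span_iff_exists_finset_subset.mp
    (h.mem_span (simpleRoot_eq_zero hi))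
  have hsupp : ∀ (T : Finset (ι → ℝ)), T ⊆ S → ∀ (b : (ι → ℝ) → ℝ), ∀ k ∉ J,
      (∑ γ ∈ T, b γ • γ) k = 0 := by
    intro T hT b k hk
    rw [Finset.sum_apply]
    refine Finset.sum_eq_zero fun γ hγ => ?_
    rw [Pi.smul_apply, h.eq_zero (hSC (hT hγ)) k hk, smul_zero]
  -- E is positive definite on V_J, because 2E(x, x) = K(x, x).
  have hdef : ∀ (T : Finset (ι → ℝ)), T ⊆ S → ∀ (b : (ι → ℝ) → ℝ),
      E (∑ γ ∈ T, b γ • γ) (∑ γ ∈ T, b γ • γ) ≤ 0 → ∑ γ ∈ T, b γ • γ = 0 := by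
    intro T hT b hb
    have h4 := hE.add_flip hδ hfin h.isCoxeterElement (hsupp T hT b) (hsupp T hT b)
    by_contra h5
    have h6 := hfin.symForm_pos hδ h5
    linarith
  obtain ⟨P, hP⟩ : ∃ P, P = S.filter (fun γ => 0 ≤ γ) := ⟨_, rfl⟩
  obtain ⟨N, hN⟩ : ∃ N, N = S.filter (fun γ => ¬ 0 ≤ γ) := ⟨_, rfl⟩
  have hPS : P ⊆ S := hP ▸ Finset.filter_subset _ _
  have hNS : N ⊆ S := hN ▸ Finset.filter_subset _ _
  have hPpos : ∀ γ ∈ P, 0 ≤ γ := fun γ hγ => by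
    rw [hP] at hγ
    exact (Finset.mem_filter.mp hγ).2
  have hNneg : ∀ γ ∈ N, γ ≤ 0 := fun γ hγ => by
    rw [hN] at hγ
    exact ((h.isRoot (hSC (Finset.mem_filter.mp hγ).1)).nonneg_or_nonpos hδ hfin).resolve_left
      (Finset.mem_filter.mp hγ).2
  have hsplit : ∀ b : (ι → ℝ) → ℝ,
      ∑ γ ∈ S, b γ • γ = ∑ γ ∈ P, b γ • γ + ∑ γ ∈ N, b γ • γ := fun b => by
    rw [hP, hN, Finset.sum_filter_add_sum_filter_not]
  have hzero : ∀ γ ∈ P, ∀ η ∈ N, E γ η = 0 := fun γ hγ η hη =>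
    h1 γ (hSC (hPS hγ)) η (hSC (hNS hη)) (hPpos γ hγ) (hNneg η hη)
  rw [hsplit] at hsum
  -- Since E vanishes from P to N, pairing γ in P with α_i sees only the P-part, with value E(γ,
  -- α_i) = δ_i γ_i ≥ 0.
  have hPsum := sum_smul_eq_sum_posPart_smul E P a
    (fun γ hγ η hη hne =>
      h2 γ (hSC (hPS hγ)) η (hSC (hPS hη)) hne (hPpos γ hγ) (hPpos η hη))
    (hdef P hPS) (fun γ hγ => by
      have h4 := hfinal γ (h.eq_zero (hSC (hPS hγ)))
      have h5 : E γ (∑ η ∈ N, a η • η) = 0 := by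
        rw [map_sum]
        exact Finset.sum_eq_zero fun η hη => by rw [map_smul, hzero γ hγ η hη, smul_zero]
      rw [← hsum, map_add, h5, add_zero] at h4
      rw [h4]
      exact mul_nonneg (hδ.1 i).le (hPpos γ hγ i))
  -- For γ in N the transposed form sees only the N-part, with value E(α_i, γ) = -δ_i (s_i γ)_i.
  -- This is nonnegative because γ ≠ -α_i, so s_i γ stays negative.
  have hNsum := sum_smul_eq_sum_posPart_smul E.flip N a
    (fun γ hγ η hη hne =>
      h3 η (hSC (hNS hη)) γ (hSC (hNS hγ)) hne.symm (hNneg η hη) (hNneg γ hγ))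
    (hdef N hNS) (fun γ hγ => by
      have hγC := hSC (hNS hγ)
      have h4 := hE.add_flip hδ hfin h.isCoxeterElement (h.eq_zero hγC) (simpleRoot_eq_zero hi)
      have h5 : E (∑ η ∈ P, a η • η) γ = 0 := by
        rw [map_sum, LinearMap.sum_apply]
        exact Finset.sum_eq_zero fun η hη => by
          rw [map_smul, LinearMap.smul_apply, hzero η hη γ hγ, smul_zero]
      have h6 : E (simpleRoot i) γ = E (∑ η ∈ N, a η • η) γ := by
        rw [← hsum, map_add, LinearMap.add_apply, h5, zero_add]
      have hne : γ ≠ -simpleRoot i := by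
        rintro rfl
        have h7 := h.inv_apply_nonneg hδ hfin hγC
        rw [map_neg, Left.nonneg_neg_iff] at h7
        exact ((isRoot_simpleRoot i).map (inv_mem h.mem_weylGroup)).ne_zero (le_antisymm h7 hv)
      have h8 := (h.isRoot hγC).s_nonpos hδ hfin (hNneg γ hγ) hne i
      rw [hfinal γ (h.eq_zero hγC), hδ.symForm_simpleRoot_right, h6] at h4
      rw [s_apply_self, Pi.zero_apply] at h8
      change 0 ≤ E (∑ η ∈ N, a η • η) γ
      have h9 := mul_nonneg (hδ.1 i).le (neg_nonneg.mpr h8)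
      linarith)
  refine ⟨fun γ => (a γ)⁺, S, hSC, fun γ => posPart_nonneg _, ?_⟩
  rw [hsplit, ← hPsum, ← hNsum, hsum]

theorem mem_cone_nonneg {C : Set (ι → ℝ)} {a : (ι → ℝ) → ℝ} {S : Finset (ι → ℝ)} {x : ι → ℝ}
    (hS : ↑S ⊆ C) (ha : ∀ γ, 0 ≤ a γ) (hx : ∑ γ ∈ S, a γ • γ = x) (p : (ι → ℝ) →ₗ[ℝ] ℝ)
    (hp : ∀ γ ∈ C, 0 ≤ p γ) : 0 ≤ p x := by
  rw [← hx, map_sum]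
  refine Finset.sum_nonneg fun γ hγ => ?_
  rw [map_smul, smul_eq_mul]
  exact mul_nonneg (ha γ) (hp γ (hS hγ))

/-- The case of `IsLabelSet.simpleRoot_mem_cone` that occurs in the recursion. -/
theorem IsLabelSet.simpleRoot_mem_cone_of_descent (hδ : SkewSymmetrizes δ B)
    (hfin : IsFiniteType B) (hi : IsInitial B J c i) (hl : len B (s B i * v) < len B v)
    (h : IsLabelSet B J (s B i * c * s B i) (s B i * v) C) (hE : IsEuler δ B J c E) :
    ∃ (a : (ι → ℝ) → ℝ) (S : Finset (ι → ℝ)), ↑S ⊆ C ∧ (∀ γ, 0 ≤ a γ) ∧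
      ∑ γ ∈ S, a γ • γ = simpleRoot i :=
  h.simpleRoot_mem_cone hδ hfin (hE.conj hδ hi.mem) hi.mem
    (fun _ hx => hE.conj_final hδ hfin hi hx)
    (inv_simpleRoot_nonneg hδ hfin h.mem_weylGroup (by rwa [← mul_assoc, s_mul_self, one_mul]))

/-- If `v s_j` is covered by `v`, then `v α_j` is a label of `v`. -/
theorem IsLabelSet.apply_simpleRoot_mem (hδ : SkewSymmetrizes δ B) (hfin : IsFiniteType B)
    (h : IsLabelSet B J c v C) (hE : IsEuler δ B J c E) {j : ι} (hj : v (simpleRoot j) ≤ 0) :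
    v (simpleRoot j) ∈ C := by
  induction h generalizing E with
  | one J c hc =>
    exact absurd (le_antisymm hj (simpleRoot_nonneg j)) (simpleRoot_ne_zero j)
  | descent J c v i C hi hl h ih =>
    obtain ⟨u, hu⟩ : ∃ u, u = s B i * v := ⟨_, rfl⟩
    have hv : v = s B i * u := by rw [hu, ← mul_assoc, s_mul_self, one_mul]
    have huW : u ∈ weylGroup B := hu ▸ h.mem_weylGroup
    have hroot : IsRoot B (u (simpleRoot j)) := (isRoot_simpleRoot j).map huW
    have ih' := ih (hE.conj hδ hi.mem)
    rw [← hu] at ih'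
    suffices u (simpleRoot j) ∈ C from ⟨_, this, by rw [hv, LinearEquiv.mul_apply]⟩
    rcases hroot.nonneg_or_nonpos hδ hfin with h0 | h0
    · have hui : u (simpleRoot j) = simpleRoot i := by
        by_contra hne
        rw [hv, LinearEquiv.mul_apply] at hj
        exact (hroot.map (s_mem B i)).ne_zero (le_antisymm hj (hroot.s_nonneg hδ hfin h0 hne))
      -- Apply u⁻¹ to a nonnegative expression of α_i in labels. The vectors u⁻¹ γ are nonnegative
      -- and combine to α_j, so each γ with a nonzero coefficient satisfies u⁻¹ γ = α_j.
      obtain ⟨a, S, hSC, ha, hsum⟩ := h.simpleRoot_mem_cone_of_descent hδ hfin hi hl hE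
      have hinv : u⁻¹ (simpleRoot i) = simpleRoot j := by
        rw [← hui, ← LinearEquiv.mul_apply, inv_mul_cancel]
        rfl
      have hsum' : ∑ γ ∈ S, a γ • u⁻¹ γ = simpleRoot j := by
        rw [← hinv, ← hsum, map_sum]
        simp only [map_smul]
      have hnonneg : ∀ γ ∈ S, 0 ≤ u⁻¹ γ := fun γ hγ => by
        have := h.inv_apply_nonneg hδ hfin (hSC hγ)
        rwa [← hu] at this
      obtain ⟨γ, hγ, haγ⟩ : ∃ γ ∈ S, a γ ≠ 0 := by
        by_contra! hcon
        refine simpleRoot_ne_zero i ?_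
        rw [← hsum]
        exact Finset.sum_eq_zero fun γ hγ => by rw [hcon γ hγ, zero_smul]
      have hzero : ∀ k, k ≠ j → u⁻¹ γ k = 0 := by
        intro k hk
        have h1 := congrFun hsum' k
        rw [Finset.sum_apply, simpleRoot_apply, if_neg hk] at h1
        have h2 := (Finset.sum_eq_zero_iff_of_nonneg (fun η hη => by
          rw [Pi.smul_apply, smul_eq_mul]
          exact mul_nonneg (ha η) (hnonneg η hη k))).mp h1 γ hγ
        rw [Pi.smul_apply, smul_eq_mul] at h2
        exact (mul_eq_zero.mp h2).resolve_left haγ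
      have hγj := ((h.isRoot (hSC hγ)).map (inv_mem huW)).eq_simpleRoot_of_smul (i := j)
        (hnonneg γ hγ j) (funext fun k => by
          by_cases hk : k = j
          · simp [hk, simpleRoot_apply]
          · simp [simpleRoot_apply, hk, hzero k hk])
      rw [← hγj, ← LinearEquiv.mul_apply, mul_inv_cancel]
      exact hSC hγ
    · exact ih' h0
  | ascent J c v i C hi hl h ih =>
    exact Set.mem_insert_of_mem _ (ih (hE.erase hδ hfin hi) hj)

/-- For a positive nonsimple root `β` with `β` or `-β` in `C_c(v)`, the vector `ω_c(·, β)` is not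
in `Cone_c(v)`. -/
theorem IsLabelSet.exists_omega_neg (hδ : SkewSymmetrizes δ B) (hfin : IsFiniteType B)
    (h : IsLabelSet B J c v C) (hE : IsEuler δ B J c E) {β : ι → ℝ}
    (hβC : β ∈ C ∨ -β ∈ C) (hβ : 0 ≤ β) (hne : ∀ i, β ≠ simpleRoot i) :
    ∃ γ ∈ C, E γ β - E β γ < 0 := by
  induction h generalizing E β with
  | one J c hc =>
    rcases hβC with ⟨j, _, hj⟩ | ⟨j, _, hj⟩
    · exact absurd hj.symm (hne j)
    · rw [eq_comm, neg_eq_iff_eq_neg] at hj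
      rw [hj, Left.nonneg_neg_iff] at hβ
      exact absurd (le_antisymm hβ (simpleRoot_nonneg j)) (simpleRoot_ne_zero j)
  | descent J c v i C hi hl h ih =>
    have hβC' : s B i β ∈ C ∨ -(s B i β) ∈ C := by
      rcases hβC with ⟨x, hx, rfl⟩ | ⟨x, hx, hx'⟩
      · left
        rwa [s_s]
      · right
        rwa [← map_neg, ← hx', s_s]
    have hroot : IsRoot B (s B i β) := by
      rcases hβC' with h1 | h1
      · exact h.isRoot h1
      · simpa using (h.isRoot h1).neg
    have hsupp : ∀ k ∉ J, s B i β k = 0 := by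
      rcases hβC' with h1 | h1
      · exact h.eq_zero h1
      · intro k hk
        simpa using h.eq_zero h1 k hk
    have hroot' : IsRoot B β := by simpa [s_s] using hroot.map (s_mem B i)
    by_cases hs : ∀ j, s B i β ≠ simpleRoot j
    · obtain ⟨γ, hγ, hlt⟩ := ih (hE.conj hδ hi.mem) hβC' (hroot'.s_nonneg hδ hfin hβ (hne i)) hs
      refine ⟨_, ⟨γ, hγ, rfl⟩, ?_⟩
      simpa only [conjForm_apply, s_s] using hlt
    · push Not at hs
      obtain ⟨j, hj⟩ := hs
      have hjJ : j ∈ J := by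
        by_contra hjJ
        simpa [hj, simpleRoot_apply] using hsupp j hjJ
      have hβj : β = simpleRoot j - (cartan B i j : ℝ) • simpleRoot i := by
        rw [← s_simpleRoot, ← hj, s_s]
      have hji : i ≠ j := by
        rintro rfl
        rw [cartan_self] at hβj
        have h1 := hβ i
        rw [hβj] at h1
        norm_num [simpleRoot_apply] at h1
      have hneg : (cartan B i j : ℝ) < 0 := by
        refine lt_of_le_of_ne (by exact_mod_cast cartan_nonpos hji) fun h0 => hne j ?_
        rw [hβj, h0, zero_smul, sub_zero]
      by_contra! hcon
      -- The pullback by s_i of the functional at β is the antisymmetrized conjugate form paired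
      -- with α_j. If it is nonnegative on C, it is nonnegative on α_i.
      obtain ⟨a, S, hSC, ha, hsum⟩ := h.simpleRoot_mem_cone_of_descent hδ hfin hi hl hE
      have h1 := mem_cone_nonneg hSC ha hsum
        ((conjForm B i E).flip (simpleRoot j) - conjForm B i E (simpleRoot j)) (fun γ hγ => by
          have h2 := hcon _ ⟨γ, hγ, rfl⟩
          change 0 ≤ E (s B i γ) (s B i (simpleRoot j)) - E (s B i (simpleRoot j)) (s B i γ)
          rwa [← hj, s_s])
      -- Finality makes the conjugate form vanish at (α_j, α_i), so its value at (α_i, α_j) is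
      -- K(α_i, α_j) = δ_i a_ij < 0.
      have h2 := hE.conj_final hδ hfin hi (simpleRoot_eq_zero hjJ)
      rw [simpleRoot_apply, if_neg hji, mul_zero] at h2
      have h3 := (hE.conj hδ hi.mem).add_flip hδ hfin hi.conj (simpleRoot_eq_zero hi.mem)
        (simpleRoot_eq_zero hjJ)
      rw [symForm_simpleRoot_left, corootForm_simpleRoot, h2, add_zero] at h3
      change 0 ≤ conjForm B i E (simpleRoot i) (simpleRoot j) -
        conjForm B i E (simpleRoot j) (simpleRoot i) at h1
      rw [h2, h3, sub_zero] at h1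
      exact absurd h1 (not_le.mpr (mul_neg_of_pos_of_neg (hδ.1 i) hneg))
  | ascent J c v i C hi hl h ih =>
    have hβC' : β ∈ C ∨ -β ∈ C := by
      rcases hβC with (h1 | h1) | (h1 | h1)
      · exact absurd h1 (hne i)
      · exact Or.inl h1
      · rw [neg_eq_iff_eq_neg] at h1
        rw [h1, Left.nonneg_neg_iff] at hβ
        exact absurd (le_antisymm hβ (simpleRoot_nonneg i)) (simpleRoot_ne_zero i)
      · exact Or.inr h1
    obtain ⟨γ, hγ, hlt⟩ := ih (hE.erase hδ hfin hi) hβC' hβ hne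
    exact ⟨γ, Set.mem_insert_of_mem _ hγ, hlt⟩

end LabelSet

/-! ### From labels to walls -/

section Walls

variable {B : Matrix ι ι ℤ} {δ : ι → ℝ} {J : Finset ι} {c v : (ι → ℝ) ≃ₗ[ℝ] (ι → ℝ)}
  {C : Set (ι → ℝ)}

theorem SkewSymmetrizes.halfForm_sub_flip (hδ : SkewSymmetrizes δ B) (x y : ι → ℝ) :
    halfForm δ B x y - halfForm δ B y x = omegaVec δ B y x := by
  change _ = omega δ B x y
  rw [halfForm_apply, halfForm_apply, hδ.symForm_comm y x, hδ.omega_neg y x]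
  ring

theorem IsCoxeterElementOf.isEuler_halfForm (hδ : SkewSymmetrizes δ B)
    (hc : IsCoxeterElementOf B c) : IsEuler δ B Finset.univ c (halfForm δ B) := by
  obtain ⟨l, hl, hp⟩ := hc
  exact hl.isEuler_halfForm hδ hp

theorem IsLabelSet.omegaVec_notMem_dualCone (hδ : SkewSymmetrizes δ B) (hfin : IsFiniteType B)
    (hc : IsCoxeterElementOf B c) (h : IsLabelSet B Finset.univ c v C) {β : ι → ℝ}
    (hβC : β ∈ C ∨ -β ∈ C) (hβ : 0 ≤ β) (hne : ∀ i, β ≠ simpleRoot i) :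
    omegaVec δ B β ∉ dualCone C := by
  intro hmem
  obtain ⟨γ, hγ, hlt⟩ := h.exists_omega_neg hδ hfin (hc.isEuler_halfForm hδ) hβC hβ hne
  rw [hδ.halfForm_sub_flip] at hlt
  exact hlt.not_ge (hmem γ hγ)

/-- The cover reflections of `v` correspond to labels of `v`, up to a scalar. -/
theorem IsLabelSet.exists_smul_eq_of_mem_cov (hδ : SkewSymmetrizes δ B) (hfin : IsFiniteType B)
    (hc : IsCoxeterElementOf B c) (h : IsLabelSet B Finset.univ c v C)
    {t : (ι → ℝ) ≃ₗ[ℝ] (ι → ℝ)} (ht : t ∈ cov B v) {β : ι → ℝ}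
    (htβ : IsReflectionWithRoot B t β) : ∃ γ ∈ C, γ ≤ 0 ∧ ∃ a : ℝ, a ≠ 0 ∧ γ = a • β := by
  obtain ⟨-, hlen, j, hj⟩ := ht
  obtain ⟨-, w, hw, k, rfl, rfl⟩ := htβ
  rw [hj] at hlen
  have hneg := apply_simpleRoot_nonpos hδ hfin h.mem_weylGroup hlen
  refine ⟨_, h.apply_simpleRoot_mem hδ hfin (hc.isEuler_halfForm hδ) hneg, hneg, ?_⟩
  -- Evaluating t v = v s_j at α_j shows that t negates v α_j, and a reflection negates only
  -- multiples of its root.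
  have hj' := congrArg (fun f : (ι → ℝ) ≃ₗ[ℝ] (ι → ℝ) => f (simpleRoot j)) hj
  simp only [LinearEquiv.mul_apply v, LinearEquiv.mul_apply _ v] at hj'
  rw [s_simpleRoot_self, map_neg, hδ.conj_s_apply hw] at hj'
  obtain ⟨γ, hγ⟩ : ∃ γ, γ = v (simpleRoot j) := ⟨_, rfl⟩
  rw [← hγ] at hj' ⊢
  obtain ⟨a, ha⟩ : ∃ a, a = 2 * symForm δ B (w (simpleRoot k)) γ /
      symForm δ B (w (simpleRoot k)) (w (simpleRoot k)) := ⟨_, rfl⟩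
  rw [← ha] at hj'
  have heq : γ = (a / 2) • w (simpleRoot k) := by
    have h1 : (2 : ℝ) • γ = a • w (simpleRoot k) := by
      rw [two_smul, ← sub_eq_zero]
      rw [sub_eq_iff_eq_add] at hj'
      nth_rewrite 1 [hj']
      abel
    rw [div_eq_inv_mul, mul_smul, ← h1, smul_smul]
    norm_num
  refine ⟨a / 2, fun h0 => ?_, heq⟩
  rw [h0, zero_smul] at heq
  exact ((isRoot_simpleRoot j).map h.mem_weylGroup).ne_zero (hγ ▸ heq)

/-- The facet of the cone at a label spans the hyperplane orthogonal to the label. -/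
theorem IsLabelSet.eq_smul_of_subset_perp (h : IsLabelSet B Finset.univ c v C) {γ β : ι → ℝ}
    (hγ : γ ∈ C) (hsub : dualCone C ∩ perp γ ⊆ perp β) : ∃ a : ℝ, β = a • γ := by
  have hspan : ∀ z : ι → ℝ, z ∈ Submodule.span ℝ C := fun z =>
    h.mem_span fun k hk => absurd (Finset.mem_univ k) hk
  have hli : LinearIndependent ℝ (Subtype.val : C → ι → ℝ) := h.linearIndepOn
  -- The dual basis vector at a label η ≠ γ lies in the facet, hence kills β; only the γ-coordinate
  -- of β survives.
  let b : Module.Basis C ℝ (ι → ℝ) := Module.Basis.mk hli (by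
    rw [Subtype.range_coe]
    exact fun z _ => hspan z)
  have hb : ∀ η : C, b η = η := fun η => Module.Basis.mk_apply _ _ _
  have hcoord : ∀ η η' : C, b.coord η η' = if η' = η then 1 else 0 := fun η η' => by
    classical
    rw [← hb η', Module.Basis.coord_apply, Module.Basis.repr_self, Finsupp.single_apply]
  refine ⟨b.coord ⟨γ, hγ⟩ β, ?_⟩
  refine b.ext_elem fun η => ?_
  rw [map_smul, Finsupp.smul_apply, ← Module.Basis.coord_apply, ← Module.Basis.coord_apply,
    hcoord η ⟨γ, hγ⟩]
  split_ifs with hη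
  · rw [← hη, smul_eq_mul, mul_one]
  · rw [smul_zero]
    refine hsub (a := b.coord η) ⟨fun η' hη' => ?_, ?_⟩
    · rw [hcoord η ⟨η', hη'⟩]
      split_ifs <;> simp
    · change b.coord η γ = 0
      rw [hcoord η ⟨γ, hγ⟩, if_neg hη]

end Walls

end CambScat

end

/-! ### The main theorem -/

theorem mainTheorem7 {ι : Type*} [Fintype ι] [DecidableEq ι] (𝕜 : Type*) [Field 𝕜] [CharZero 𝕜]
    (B : Matrix ι ι ℤ) (δ : ι → ℝ) (hδ : CambScat.SkewSymmetrizes δ B)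
    (hacyclic : CambScat.IsAcyclic B) (hfinite : CambScat.IsFiniteType B)
    (c : (ι → ℝ) ≃ₗ[ℝ] (ι → ℝ)) (hc : CambScat.IsCoxeterElementOf B c) :
    (∀ W ∈ CambScat.cambScat 𝕜 B c,
      (∀ i, ¬ W.1 ⊆ CambScat.perp (CambScat.simpleRoot i)) → CambScat.IsOutgoing δ B W.1) ∧
    (∀ v C, CambScat.IsSortable B Finset.univ c v → CambScat.IsLabelSet B Finset.univ c v C →
      ∀ β ∈ C, β ∈ CambScat.positiveRoots B → (∀ i, β ≠ CambScat.simpleRoot i) →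
        CambScat.omegaVec δ B β ∉ CambScat.dualCone C) := by
  refine ⟨?_, fun v C _ h β hβC hβ hne =>
    h.omegaVec_notMem_dualCone hδ hfinite hc (Or.inl hβC) hβ.2 hne⟩
  rintro _ ⟨v, C, t, m, -, h, ht, htm, rfl⟩ hnot ⟨β, ⟨⟨hβ0, hβne⟩, -⟩, hsub, hβC, -⟩
  obtain ⟨γ, hγC, hγ, a, ha, hγa⟩ := h.exists_smul_eq_of_mem_cov hδ hfinite hc ht htm
  have hperp : ∀ p, p ∈ CambScat.perp γ ↔ p ∈ CambScat.perp (fun i => (m i : ℝ)) := fun p => by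
    simp only [CambScat.perp, Set.mem_ofPred_eq]
    rw [hγa, map_smul, smul_eq_mul, mul_eq_zero]
    simp [ha]
  have hsub' : CambScat.dualCone C ∩ CambScat.perp γ ⊆
      CambScat.perp (fun i => (β i : ℝ)) :=
    fun p hp => hsub ⟨hp.1, (hperp p).mp hp.2⟩
  -- The normal vector β is k γ, where γ is nonpositive and β is nonnegative and nonzero; hence k <
  -- 0.
  obtain ⟨k, hk⟩ := h.eq_smul_of_subset_perp hγC hsub'
  obtain ⟨i, hi⟩ := Function.ne_iff.mp hβne
  have hβi : (0 : ℝ) < β i := by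
    have := lt_of_le_of_ne (hβ0 i) (Ne.symm hi)
    exact_mod_cast this
  have hk0 : k < 0 := by
    have h1 : (β i : ℝ) = k * γ i := congrFun hk i
    by_contra! hk0
    exact (h1 ▸ hβi).not_ge (mul_nonpos_of_nonneg_of_nonpos hk0 (hγ i))
  -- -γ is a positive root whose negative is a label, and β = (-k)(-γ) with -k > 0, so ω(·, -γ)
  -- would lie in the cone together with ω(·, β). If -γ were some α_j, the wall would lie in α_j^⊥.
  refine h.omegaVec_notMem_dualCone hδ hfinite hc (β := -γ) (Or.inr (by rwa [neg_neg]))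
    (neg_nonneg.mpr hγ) (fun j hj => hnot j fun p hp => ?_) fun η hη => ?_
  · have h1 : p γ = 0 := (hperp p).mpr hp.2
    change p (CambScat.simpleRoot j) = 0
    rw [← hj, map_neg, h1, neg_zero]
  · have h1 := hβC η hη
    rw [hk] at h1
    simp only [CambScat.omegaVec, map_smul, map_neg, LinearMap.smul_apply, LinearMap.neg_apply,
      smul_eq_mul] at h1 ⊢
    exact neg_nonneg.mpr (nonpos_of_mul_nonneg_right h1 hk0)
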